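/- Notation. $\mathbb N=\{1,2,\dots\}$. For a finite set $X$, a subset $\mathcal R$ of the free group $F(X)$ with normal closure $\langle\!\langle \mathcal R\rangle\!\rangle$, and $w\in\langle\!\langle \mathcal R\rangle\!\rangle$, let $\mathrm{Area}_{\mathcal R}(w)$ be the least $\ell$ such that $w=\prod_{i=1}^{\ell} f_i^{-1}R_i^{\varepsilon_i}f_i$ in $F(X)$ with $f_i\in F(X)$, $R_i\in\mathcal R$, $\varepsilon_i=\pm1$. Write $\|w\|$ for the length of a word $w$ in $X\cup X^{-1}$. The Dehn function of a finite presentation $\langle X\mid\mathcal R\rangle$ is $\delta(n)=\max\{\mathrm{Area}_{\mathcal R}(w)\mid w\in\langle\!\langle\mathcal R\rangle\!\rangle,\ \|w\|\le n\}$. For functions $\alpha,\beta\colon\mathbb N\to\mathbb N\cup\{0\}$ write $\alpha\precsim\beta$ if there is $C\in\mathbb N$ with $\alpha(n)\le C\beta(Cn)+Cn$ for all $n\in\mathbb N$, and $\alpha\approx\beta$ if $\alpha\precsim\beta$ and $\beta\precsim\alpha$. A finitely presented group has quadratic Dehn function if the Dehn function of some finite presentation of it is $\approx n^2$. Let $G$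 be a group generated by a finite set $X$. For $k\in\mathbb N$ let $\mathcal S_k$ be the set of all words of length at most $k$ in $X\cup X^{-1}$ representing $1$ in $G$. The isoperimetric spectrum of $G$ with respect to $X$ is the function $$f_{G,X}(k,m,n)=\max\{\mathrm{Area}_{\mathcal S_m}(w)\mid w\in\langle\!\langle\mathcal S_k\rangle\!\rangle,\ \|w\|\le n\}$$ of triples $(k,m,n)\in\mathbb N^3$ with $m\ge k$. Let $\mathcal F$ be the set of real-valued functions of such triples that are non-decreasing in $k$ and in $n$ and non-increasing in $m$. For $f,g\in\mathcal F$ write $f\preccurlyeq g$ if there is $C\in\mathbb N$ such that $$f(k,Cm,n)\le C\,g(Ck,m,Cn)+C\frac nm+C$$ for all $(k,m,n)\in\mathbb N^3$ with $m\ge Ck$, and write $f\sim g$ if $f\preccurlyeq g$ and $g\preccurlyeq f$. Corollary. Let $G$ be a finitely presented group with quadratic Dehn function. Then for every finite generating set $X$ of $G$, the functions $f_{G,X}(k,m,n)$ and $(n/m)^2$ belong to $\mathcal F$ and $f_{G,X}(k,m,n)\sim (n/m)^2$. -/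

import Mathlib

namespace IsoSpectrum

section Area

variable {α : Type*}

/-- `w` is a product of `l` conjugates `f⁻¹ r^{±1} f` with `r ∈ R`, in the free group on `α`. -/
def IsConjProduct (R : Set (FreeGroup α)) (w : FreeGroup α) (l : ℕ) : Prop :=
  ∃ L : List (FreeGroup α), L.length = l ∧
    (∀ g ∈ L, ∃ f : FreeGroup α, ∃ r ∈ R, g = f⁻¹ * r * f ∨ g = f⁻¹ * r⁻¹ * f) ∧
    L.prod = w

/-- The area of `w` over `R`: the least number of factors in a decomposition of `w` as a product
of conjugates of elements of `R` and of their inverses. It is only used for `w` in the normal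
closure of `R`, where such a decomposition exists. -/
noncomputable def area (R : Set (FreeGroup α)) (w : FreeGroup α) : ℕ :=
  sInf {l : ℕ | IsConjProduct R w l}

/-- The areas over `R` of the words of length at most `n` (reduced or not, in the letters of `α`
and their inverses) that represent an element of the normal closure of `T`. -/
def areaSet (R T : Set (FreeGroup α)) (n : ℕ) : Set ℕ :=
  {a : ℕ | ∃ w : List (α × Bool), w.length ≤ n ∧
    FreeGroup.mk w ∈ Subgroup.normalClosure T ∧ a = area R (FreeGroup.mk w)}

/-- The Dehn function of the presentation `⟨α ∣ R⟩`. The supremum is a maximum when `α` is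
finite, see `isGreatest_dehn`. -/
noncomputable def dehn (R : Set (FreeGroup α)) (n : ℕ) : ℕ := sSup (areaSet R R n)

theorem exists_isConjProduct {R : Set (FreeGroup α)} {w : FreeGroup α}
    (hw : w ∈ Subgroup.normalClosure R) : ∃ l, IsConjProduct R w l := by
  induction hw using Subgroup.closure_induction with
  | mem x hx =>
    obtain ⟨r, hr, hc⟩ := Group.mem_conjugatesOfSet_iff.1 hx
    obtain ⟨c, hc⟩ := isConj_iff.1 hc
    refine ⟨1, [x], rfl, ?_, by simp⟩
    intro g hg
    rw [List.mem_singleton] at hg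
    exact ⟨c⁻¹, r, hr, Or.inl (by rw [hg, ← hc]; simp)⟩
  | one => exact ⟨0, [], rfl, by simp, rfl⟩
  | mul x y _ _ hx hy =>
    obtain ⟨_, L, -, hL, rfl⟩ := hx
    obtain ⟨_, M, -, hM, rfl⟩ := hy
    refine ⟨_, L ++ M, rfl, ?_, by simp⟩
    intro g hg
    rcases List.mem_append.1 hg with h | h
    · exact hL g h
    · exact hM g h
  | inv x _ hx =>
    obtain ⟨_, L, -, hL, rfl⟩ := hx
    refine ⟨_, (L.map (·⁻¹)).reverse, rfl, ?_, (List.prod_inv_reverse L).symm⟩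
    intro g hg
    simp only [List.mem_reverse, List.mem_map] at hg
    obtain ⟨a, ha, rfl⟩ := hg
    obtain ⟨f, r, hr, h | h⟩ := hL a ha
    · exact ⟨f, r, hr, Or.inr (by rw [h]; group)⟩
    · exact ⟨f, r, hr, Or.inl (by rw [h]; group)⟩

theorem isGreatest_areaSet [Finite α] (R T : Set (FreeGroup α)) (n : ℕ) :
    IsGreatest (areaSet R T n) (sSup (areaSet R T n)) := by
  have hfin : (areaSet R T n).Finite := by
    refine ((List.finite_length_le (α × Bool) n).image
      (fun w => area R (FreeGroup.mk w))).subset ?_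
    rintro a ⟨w, hw, -, rfl⟩
    exact ⟨w, hw, rfl⟩
  have hne : (areaSet R T n).Nonempty :=
    ⟨_, [], by simp, by rw [← FreeGroup.one_eq_mk]; exact one_mem _, rfl⟩
  exact ⟨Nat.sSup_mem hne hfin.bddAbove, fun a ha => le_csSup hfin.bddAbove ha⟩

theorem isGreatest_dehn [Finite α] (R : Set (FreeGroup α)) (n : ℕ) :
    IsGreatest (areaSet R R n) (dehn R n) :=
  isGreatest_areaSet R R n

end Area

section Spectrum

variable {ι G : Type*} [Group G]

/-- The set `S_k` of (elements of the free group given by) words of length at most `k` in the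
generators `x i` and their inverses that represent `1` in `G`. -/
def shortRelations (x : ι → G) (k : ℕ) : Set (FreeGroup ι) :=
  {g | ∃ w : List (ι × Bool), w.length ≤ k ∧ FreeGroup.mk w = g ∧ FreeGroup.lift x g = 1}

/-- The isoperimetric spectrum of `G` with respect to the generating family `x`, meaningful for
`k ≤ m`: the maximal area over `S_m` of words of length at most `n` in the normal closure of
`S_k`. The supremum is a maximum when `ι` is finite, see `isGreatest_spectrum`. -/
noncomputable def spectrum (x : ι → G) (k m n : ℕ) : ℕ :=
  sSup (areaSet (shortRelations x m) (shortRelations x k) n)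

theorem isGreatest_spectrum [Finite ι] (x : ι → G) (k m n : ℕ) :
    IsGreatest (areaSet (shortRelations x m) (shortRelations x k) n) (spectrum x k m n) :=
  isGreatest_areaSet _ _ n

/-- For `k ≤ m` the areas entering the definition of `spectrum` are areas of words which really
are products of conjugates of elements of `S_m`. -/
theorem mem_normalClosure_of_le (x : ι → G) {k m : ℕ} (hkm : k ≤ m) {w : FreeGroup ι}
    (hw : w ∈ Subgroup.normalClosure (shortRelations x k)) :
    w ∈ Subgroup.normalClosure (shortRelations x m) := by
  refine Subgroup.normalClosure_mono ?_ hw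
  rintro g ⟨u, hu, h⟩
  exact ⟨u, hu.trans hkm, h⟩

end Spectrum

/-- The class `𝓕` of real functions of triples of positive integers `(k, m, n)` with `k ≤ m`
that are non-decreasing in `k` and in `n` and non-increasing in `m`. Values at other triples
are irrelevant. -/
structure InClassF (f : ℕ → ℕ → ℕ → ℝ) : Prop where
  mono_fst : ∀ k k' m n, 0 < k → 0 < n → k ≤ k' → k' ≤ m → f k m n ≤ f k' m n
  anti_snd : ∀ k m m' n, 0 < k → 0 < n → k ≤ m → m ≤ m' → f k m' n ≤ f k m n
  mono_thd : ∀ k m n n', 0 < k → 0 < n → k ≤ m → n ≤ n' → f k m n ≤ f k m n'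

/-- The preorder `≼` on the class `𝓕`. -/
def Preceq (f g : ℕ → ℕ → ℕ → ℝ) : Prop :=
  ∃ C : ℕ, 0 < C ∧ ∀ k m n : ℕ, 0 < k → 0 < m → 0 < n → C * k ≤ m →
    f k (C * m) n ≤ C * g (C * k) m (C * n) + C * ((n : ℝ) / m) + C

/-- Equivalence `f ∼ g` of two members of the class `𝓕`. -/
def SpectrumEquiv (f g : ℕ → ℕ → ℕ → ℝ) : Prop :=
  InClassF f ∧ InClassF g ∧ Preceq f g ∧ Preceq g f

/-- The quasi-order on functions of a positive integer used to compare Dehn functions. -/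
def DehnLe (f g : ℕ → ℕ) : Prop :=
  ∃ C : ℕ, 0 < C ∧ ∀ n : ℕ, 0 < n → f n ≤ C * g (C * n) + C * n

/-- The standard equivalence of Dehn functions. -/
def DehnEquiv (f g : ℕ → ℕ) : Prop := DehnLe f g ∧ DehnLe g f

end IsoSpectrum

/-!
The two comparisons are proved separately, after `G` has been identified with `⟨α ∣ R⟩` and words
have been translated between the two generating families; a translation changes lengths by a
bounded factor and moves a word of length `n` by `O(n / m + 1)` relations of length `O(m)`
(`exists_lift_comp_eq`, `exists_chunks`).

The lower bound `preceq_spectrum` is a count. There are words of length `O(n)` with area about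
`n ^ 2` over `R`, and a relation of length at most `m` has area `O(m ^ 2)` over `R`, so about
`(n / m) ^ 2` relations of length at most `m` are needed.

The upper bound `spectrum_preceq` says that a quadratic filling can be coarsened: a word of length
`n` and area `A` over `R` is a product of `O(A / m ^ 2 + n / m + 1)` conjugates of relations of
length `O(m)` (`Diagram.exists_coarse_filling`). One would like to choose a maximal separated set
of vertices at scale `m` in a van Kampen diagram, colour each vertex by the nearest chosen one, and
read off a relation of length `O(m)` from every cell with three different colours; Euler's formula
bounds the number of these cells by twice the number of chosen vertices. As ordinary cells are
short, a chosen vertex should be responsible for about `m ^ 2` cells or for `m` boundary edges. This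
fails in long thin parts of the diagram, which have diameter far larger than `m` but few cells. Such
a part is a bubble: by the coarea inequality some sphere in it meets few cells, so that it is cut
off by a short closed curve, and it can be forgotten.

* A plane diagram is replaced by a graph with closed walks, `Diagram`, of which only three
  consequences of planarity are kept: the vanishing of the first cohomology with coefficients in
  `ℤ / 2`, the bound on colour changes coming from Euler's formula, and the fact that the boundary
  word is a product of conjugates of cells. All of them survive the insertion of a spur
  and the gluing of two boundary vertices, so that `Fillable.nonempty_diagram` gets a diagram from
  any product of conjugates by induction, without any topology.
* The `hull` of a ball adds to it the components of the complement which miss the boundary walk.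
  As the first cohomology vanishes, the edges leaving a hull form one connected family
  (`dist_le_of_mouth`); so the hull of a ball whose sphere meets at most `m` vertices of cells has
  a boundary of diameter `O(m)`, and is contained in the hull of a small ball around any of its
  boundary vertices. The boundary vertices of a maximal bubble are good in the sense of `IsGood`
  (`exists_isGood_mem_hull`), so the hulls of balls around a net of good vertices cover the graph,
  and the size of the net is controlled (`exists_net`).
* `exists_labelling` colours all vertices by the points of the net, with connected colour classes
  and with neighbours having colours at distance `O(m)`. Connectedness makes the number of colours
  an upper bound for the dimension in Euler's formula, hence for the number of cells with three
  colours and of colour changes along the boundary. Cells with at most two colours contribute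
  nothing (`along_eq_one_of_changes_le`).
-/

namespace IsoSpectrum

/-! ### Products of conjugates -/

section ConjProducts

variable {α β : Type*}

/-- `w` is a product of at most `n` conjugates of elements of `S` and of their inverses. -/
def IsConjProductLE (S : Set (FreeGroup α)) (n : ℕ) (w : FreeGroup α) : Prop :=
  ∃ l ≤ n, IsConjProduct S w l

theorem IsConjProductLE.mono {S T : Set (FreeGroup α)} {n k : ℕ} {w : FreeGroup α}
    (h : IsConjProductLE S n w) (hST : S ⊆ T) (hnk : n ≤ k) : IsConjProductLE T k w := by
  obtain ⟨l, hl, L, rfl, hL, rfl⟩ := h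
  refine ⟨_, hl.trans hnk, L, rfl, fun g hg => ?_, rfl⟩
  obtain ⟨f, r, hr, h⟩ := hL g hg
  exact ⟨f, r, hST hr, h⟩

theorem IsConjProductLE.one (S : Set (FreeGroup α)) : IsConjProductLE S 0 1 :=
  ⟨0, le_rfl, [], rfl, by simp, rfl⟩

theorem IsConjProductLE.of_mem {S : Set (FreeGroup α)} {w : FreeGroup α} (h : w ∈ S) :
    IsConjProductLE S 1 w :=
  ⟨1, le_rfl, [w], rfl, fun g hg => ⟨1, w, h, Or.inl (by simpa using hg)⟩, by simp⟩

theorem IsConjProductLE.mul {S : Set (FreeGroup α)} {n k : ℕ} {v w : FreeGroup α}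
    (hv : IsConjProductLE S n v) (hw : IsConjProductLE S k w) :
    IsConjProductLE S (n + k) (v * w) := by
  obtain ⟨_, hl, L, rfl, hL, rfl⟩ := hv
  obtain ⟨_, hk, M, rfl, hM, rfl⟩ := hw
  refine ⟨_, add_le_add hl hk, L ++ M, by simp, fun g hg => ?_, by simp⟩
  rcases List.mem_append.1 hg with h | h
  · exact hL g h
  · exact hM g h

theorem IsConjProductLE.conj {S : Set (FreeGroup α)} {n : ℕ} {w : FreeGroup α}
    (h : IsConjProductLE S n w) (c : FreeGroup α) : IsConjProductLE S n (c * w * c⁻¹) := by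
  obtain ⟨_, hl, L, rfl, hL, rfl⟩ := h
  refine ⟨_, hl, L.map (fun g => c * g * c⁻¹), by simp, fun g hg => ?_, ?_⟩
  · obtain ⟨g, hg', rfl⟩ := List.mem_map.1 hg
    obtain ⟨f, r, hr, rfl | rfl⟩ := hL g hg'
    · exact ⟨f * c⁻¹, r, hr, Or.inl (by group)⟩
    · exact ⟨f * c⁻¹, r, hr, Or.inr (by group)⟩
  · exact (map_list_prod (MulAut.conj c) L).symm

theorem IsConjProductLE.inv {S : Set (FreeGroup α)} {n : ℕ} {w : FreeGroup α}
    (h : IsConjProductLE S n w) : IsConjProductLE S n w⁻¹ := by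
  obtain ⟨_, hl, L, rfl, hL, rfl⟩ := h
  refine ⟨_, hl, (L.map (·⁻¹)).reverse, by simp, fun g hg => ?_,
    (List.prod_inv_reverse L).symm⟩
  simp only [List.mem_reverse, List.mem_map] at hg
  obtain ⟨g, hg, rfl⟩ := hg
  obtain ⟨f, r, hr, rfl | rfl⟩ := hL g hg
  · exact ⟨f, r, hr, Or.inr (by group)⟩
  · exact ⟨f, r, hr, Or.inl (by group)⟩

/-- If every element of `S` maps to a product of at most `k` conjugates over `T`, a product of
`n` conjugates over `S` maps to a product of at most `n * k` conjugates over `T`. -/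
theorem IsConjProductLE.map {S : Set (FreeGroup α)} {T : Set (FreeGroup β)} {n k : ℕ}
    {w : FreeGroup α} (h : IsConjProductLE S n w) (φ : FreeGroup α →* FreeGroup β)
    (hφ : ∀ s ∈ S, IsConjProductLE T k (φ s)) : IsConjProductLE T (n * k) (φ w) := by
  obtain ⟨_, hl, L, rfl, hL, rfl⟩ := h
  suffices H : IsConjProductLE T (L.length * k) (φ L.prod) from
    H.mono subset_rfl (Nat.mul_le_mul_right k hl)
  clear hl
  induction L with
  | nil => simpa using IsConjProductLE.one T
  | cons g L ih =>
    have h1 : IsConjProductLE T k (φ g) := by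
      obtain ⟨f, r, hr, rfl | rfl⟩ := hL g (by simp)
      · simpa using (hφ r hr).conj (φ f)⁻¹
      · simpa using ((hφ r hr).inv).conj (φ f)⁻¹
    have h2 := h1.mul (ih fun g hg => hL g (by simp [hg]))
    simpa [add_mul, add_comm] using h2

theorem area_le_iff {S : Set (FreeGroup α)} {w : FreeGroup α}
    (hw : w ∈ Subgroup.normalClosure S) {n : ℕ} :
    area S w ≤ n ↔ IsConjProductLE S n w := by
  constructor
  · intro h
    exact ⟨area S w, h, Nat.sInf_mem (exists_isConjProduct hw)⟩
  · rintro ⟨l, hl, h⟩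
    exact (Nat.sInf_le h).trans hl

theorem IsConjProductLE.area_le {S : Set (FreeGroup α)} {w : FreeGroup α} {n : ℕ}
    (h : IsConjProductLE S n w) : area S w ≤ n := by
  obtain ⟨l, hl, h⟩ := h
  exact (Nat.sInf_le h).trans hl

end ConjProducts

/-! ### Functions along lists of vertices -/

section Along

variable {V V' M L : Type*}

/-- The product of `φ` over the pairs of consecutive entries of a list. -/
def along [Monoid M] (φ : V → V → M) : List V → M
  | a :: b :: l => φ a b * along φ (b :: l)
  | _ => 1

open Classical in
/-- The number of pairs of consecutive entries of a list with different labels. -/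
noncomputable def changes (ℓ : V → L) : List V → ℕ
  | a :: b :: l => (if ℓ a = ℓ b then 0 else 1) + changes ℓ (b :: l)
  | _ => 0

theorem along_append [Monoid M] (φ : V → V → M) (P : List V) (x : V) (S : List V) :
    along φ (P ++ x :: S) = along φ (P ++ [x]) * along φ (x :: S) := by
  induction P with
  | nil => simp [along]
  | cons a P ih =>
    cases P with
    | nil => simp [along]
    | cons b P =>
      simp only [List.cons_append, along, mul_assoc] at ih ⊢
      rw [ih]

theorem changes_append (ℓ : V → L) (P : List V) (x : V) (S : List V) :
    changes ℓ (P ++ x :: S) = changes ℓ (P ++ [x]) + changes ℓ (x :: S) := by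
  induction P with
  | nil => simp [changes]
  | cons a P ih =>
    cases P with
    | nil => simp [changes]
    | cons b P => simpa [changes, add_assoc] using ih

theorem along_map [Monoid M] (φ : V' → V' → M) (q : V → V') (l : List V) :
    along φ (l.map q) = along (fun a b => φ (q a) (q b)) l := by
  induction l with
  | nil => simp [along]
  | cons a P ih =>
    cases P with
    | nil => simp [along]
    | cons b P =>
      simp only [List.map_cons, along] at ih ⊢
      rw [ih]

theorem changes_map (ℓ : V' → L) (q : V → V') (l : List V) :
    changes ℓ (l.map q) = changes (ℓ ∘ q) l := by
  induction l with
  | nil => simp [changes]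
  | cons a P ih =>
    cases P with
    | nil => simp [changes]
    | cons b P => simpa [changes] using ih

/-- A potential on the vertices telescopes along a list. -/
theorem along_eq_of_potential {adj : V → V → Prop} {c : V → V → ℤˣ} {g : V → ℤˣ}
    (h : ∀ a b, adj a b → c a b = g a * g b) (x : V) (u : List V) (y : V)
    (hu : (x :: u ++ [y]).IsChain adj) : along c (x :: u ++ [y]) = g x * g y := by
  induction u generalizing x with
  | nil =>
    have := h x y (by simpa using hu)
    simp [along, this]
  | cons z u ih =>
    have h1 : adj x z := by simp at hu; exact hu.1
    have h2 : (z :: u ++ [y]).IsChain adj := by simp at hu ⊢; exact hu.2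
    have := ih z h2
    simp only [List.cons_append, along] at this ⊢
    rw [this, h x z h1, mul_assoc, ← mul_assoc (g z), Int.units_mul_self, one_mul]

/-- Values of a function agree at the ends of a chain if they agree on all its monochromatic
steps and there is no other step. -/
theorem eq_of_changes_eq_zero {X : Type*} {adj : V → V → Prop} {ℓ : V → L} {h : V → X}
    (hh : ∀ a b, adj a b → ℓ a = ℓ b → h a = h b) (x : V) (u : List V) (y : V)
    (hu : (x :: u ++ [y]).IsChain adj) (h0 : changes ℓ (x :: u ++ [y]) = 0) : h x = h y := by
  induction u generalizing x with
  | nil =>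
    refine hh x y (by simpa using hu) ?_
    by_contra hne
    simp [changes, hne] at h0
  | cons z u ih =>
    have h1 : adj x z := by simp at hu; exact hu.1
    have h2 : (z :: u ++ [y]).IsChain adj := by simp at hu ⊢; exact hu.2
    simp only [List.cons_append, changes] at h0
    rw [← ih z h2 (by simp; omega)]
    refine hh x z h1 ?_
    by_contra hne
    simp [hne] at h0

theorem label_eq_of_changes_eq_zero {ℓ : V → L} (x : V) (u : List V) (y : V)
    (h0 : changes ℓ (x :: u ++ [y]) = 0) : ℓ x = ℓ y := by
  induction u generalizing x with
  | nil =>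
    by_contra hne
    simp [changes, hne] at h0
  | cons z u ih =>
    simp only [List.cons_append, changes] at h0
    rw [← ih z (by simp; omega)]
    by_contra hne
    simp [hne] at h0

theorem label_ne_of_changes_eq_one {ℓ : V → L} (x : V) (u : List V) (y : V)
    (h1 : changes ℓ (x :: u ++ [y]) = 1) : ℓ x ≠ ℓ y := by
  induction u generalizing x with
  | nil =>
    intro h
    simp [changes, h] at h1
  | cons z u ih =>
    simp only [List.cons_append, changes] at h1
    by_cases hz : ℓ x = ℓ z
    · rw [hz]
      exact ih z (by simpa [hz] using h1)
    · rw [if_neg hz] at h1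
      rw [← label_eq_of_changes_eq_zero (ℓ := ℓ) z u y (by simp; omega)]
      exact hz

end Along

/-! ### Diagrams -/

section Diagrams

variable {α G : Type*} [Group G]

/-- The value in `G` of a letter, when the generator `a` takes the value `y a`. -/
def letterValue (y : α → G) (a : α × Bool) : G := cond a.2 (y a.1) (y a.1)⁻¹

theorem lift_mk_cons (y : α → G) (a : α × Bool) (w : List (α × Bool)) :
    FreeGroup.lift y (FreeGroup.mk (a :: w)) =
      letterValue y a * FreeGroup.lift y (FreeGroup.mk w) := by
  simp [FreeGroup.lift_mk, letterValue]

/-- The list of vertices follows `adj`, and the successive values of `pos` differ by the letters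
of the word. -/
def Spells {V : Type*} (y : α → G) (adj : V → V → Prop) (pos : V → G) :
    List (α × Bool) → List V → Prop
  | [], l => ∃ v, l = [v]
  | a :: w, v :: v' :: l =>
    adj v v' ∧ pos v' = pos v * letterValue y a ∧ Spells y adj pos w (v' :: l)
  | _ :: _, _ => False

section Spells

variable {V V' : Type*} {y : α → G} {adj : V → V → Prop} {pos : V → G}

theorem Spells.ne_nil {w : List (α × Bool)} {l : List V} (h : Spells y adj pos w l) : l ≠ [] := by
  rintro rfl
  cases w <;> simp [Spells] at h

theorem Spells.length {w : List (α × Bool)} {l : List V} (h : Spells y adj pos w l) :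
    l.length = w.length + 1 := by
  induction w generalizing l with
  | nil => obtain ⟨v, rfl⟩ := h; rfl
  | cons a w ih =>
    match l, h with
    | v :: v' :: l, h => simpa using ih h.2.2

theorem Spells.isChain {w : List (α × Bool)} {l : List V} (h : Spells y adj pos w l) :
    l.IsChain adj := by
  induction w generalizing l with
  | nil => obtain ⟨v, rfl⟩ := h; simp
  | cons a w ih =>
    match l, h with
    | v :: v' :: l, h => exact List.isChain_cons_cons.2 ⟨h.1, ih h.2.2⟩

theorem Spells.pos_eq {w : List (α × Bool)} {x : V} {l : List V} {z : V}
    (h : Spells y adj pos w (x :: l ++ [z])) :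
    pos z = pos x * FreeGroup.lift y (FreeGroup.mk w) := by
  induction w generalizing x l with
  | nil => obtain ⟨v, hv⟩ := h; simp at hv
  | cons a w ih =>
    rw [lift_mk_cons]
    cases l with
    | nil =>
      have h1 := h.2.2.length
      have : w = [] := by simpa using h1
      subst this
      simpa [FreeGroup.lift_mk] using h.2.1
    | cons b l => rw [ih h.2.2, h.2.1, mul_assoc]

theorem Spells.map {adj' : V' → V' → Prop} {pos' : V' → G} {q : V → V'}
    (hadj : ∀ a b, adj a b → adj' (q a) (q b)) (hpos : ∀ a, pos' (q a) = pos a)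
    {w : List (α × Bool)} {l : List V} (h : Spells y adj pos w l) :
    Spells y adj' pos' w (l.map q) := by
  induction w generalizing l with
  | nil => obtain ⟨v, rfl⟩ := h; exact ⟨q v, rfl⟩
  | cons a w ih =>
    match l, h with
    | v :: v' :: l, h => exact ⟨hadj _ _ h.1, by rw [hpos, hpos]; exact h.2.1, ih h.2.2⟩

theorem Spells.append {w₁ w₂ : List (α × Bool)} {P : List V} {x : V} {S : List V}
    (h₁ : Spells y adj pos w₁ (P ++ [x])) (h₂ : Spells y adj pos w₂ (x :: S)) :
    Spells y adj pos (w₁ ++ w₂) (P ++ x :: S) := by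
  induction w₁ generalizing P with
  | nil =>
    obtain ⟨v, hv⟩ := h₁
    have : P = [] := by
      cases P with
      | nil => rfl
      | cons a P => simp at hv
    subst this
    exact h₂
  | cons a w ih =>
    match P, h₁ with
    | [v], h => exact ⟨h.1, h.2.1, ih (P := []) h.2.2⟩
    | v :: v' :: P, h => exact ⟨h.1, h.2.1, ih (P := v' :: P) h.2.2⟩

theorem Spells.exists_of_append {w₁ w₂ : List (α × Bool)} {l : List V}
    (h : Spells y adj pos (w₁ ++ w₂) l) : ∃ P x S, l = P ++ x :: S ∧
      Spells y adj pos w₁ (P ++ [x]) ∧ Spells y adj pos w₂ (x :: S) := by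
  induction w₁ generalizing l with
  | nil =>
    cases l with
    | nil => exact absurd rfl h.ne_nil
    | cons x S => exact ⟨[], x, S, rfl, ⟨x, rfl⟩, h⟩
  | cons a w ih =>
    match l, h with
    | v :: v' :: l, h =>
      obtain ⟨P, x, S, hl, h1, h2⟩ := ih h.2.2
      refine ⟨v :: P, x, S, by rw [hl]; rfl, ?_, h2⟩
      cases P with
      | nil =>
        obtain ⟨rfl, -⟩ := List.cons.inj hl
        exact ⟨h.1, h.2.1, h1⟩
      | cons b P =>
        obtain ⟨rfl, -⟩ := List.cons.inj hl
        exact ⟨h.1, h.2.1, h1⟩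

/-- A list spelling `w₁ r w₂`, for a non-empty `r`, cut at the ends of `r`. -/
theorem Spells.exists_of_append_append {w₁ r w₂ : List (α × Bool)} (hr : r ≠ []) {l : List V}
    (h : Spells y adj pos (w₁ ++ r ++ w₂) l) : ∃ P x u x' S,
      l = P ++ x :: (u ++ x' :: S) ∧ Spells y adj pos w₁ (P ++ [x]) ∧
      Spells y adj pos r (x :: u ++ [x']) ∧ Spells y adj pos w₂ (x' :: S) := by
  obtain ⟨P₂, x', S, rfl, h1, h2⟩ := h.exists_of_append
  obtain ⟨P, x, T, hT, h3, h4⟩ := h1.exists_of_append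
  rcases List.eq_nil_or_concat' T with rfl | ⟨u, z, rfl⟩
  · have := h4.length
    exact absurd (by simpa using this) hr
  · have h5 : P₂ ++ [x'] = (P ++ x :: u) ++ [z] := by simp [hT]
    obtain ⟨rfl, h6⟩ := List.append_inj' h5 rfl
    obtain rfl : x' = z := by simpa using h6
    exact ⟨P, x, u, x', S, by simp, h3, by simpa using h4, h2⟩

end Spells

/-- The space of functions which are constant along the edges with ends of the same label. For
connected monochromatic pieces its dimension is the number of these pieces. -/
def monoSpace {V : Type*} (adj : V → V → Prop) (ℓ : V → ℕ) : Submodule ℚ (V → ℚ) where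
  carrier := {h | ∀ a b, adj a b → ℓ a = ℓ b → h a = h b}
  add_mem' hf hg a b h h' := by simp [hf a b h h', hg a b h h']
  zero_mem' _ _ _ _ := rfl
  smul_mem' c f hf a b h h' := by simp [hf a b h h']

open Classical in
/-- A combinatorial substitute for a van Kampen diagram with boundary word `w` and at most `A`
cells of perimeter at most `ρ`: a finite graph mapped to `G`, a closed boundary walk reading `w`,
and closed walks bounding the cells. Planarity enters only through the last three fields.

* `exact`: the first cohomology vanishes, for coefficients `ℤˣ ≅ ℤ/2`.
* `euler`: a consequence of Euler's formula and of the fact that every edge has two sides. For a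
  labelling of the vertices it bounds the number of colour changes along the boundary and around
  the cells by the number of monochromatic components.
* `fill`: the boundary walk is a product of conjugates of the cells, each used at most once. -/
structure Diagram (y : α → G) (ρ : ℕ) (w : List (α × Bool)) (A : ℕ) where
  V : Type
  finite : Finite V
  adj : V → V → Prop
  pos : V → G
  walk : List V
  faces : List (List V)
  symm : ∀ a b, adj a b → adj b a
  adj_pos : ∀ a b, adj a b → ∃ s, pos b = pos a * letterValue y s
  conn : ∀ a b, Relation.ReflTransGen adj a b
  spells : Spells y adj pos w walk
  closed : walk.head? = walk.getLast?
  faces_length : faces.length ≤ A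
  face_chain : ∀ f ∈ faces, f.IsChain adj
  face_closed : ∀ f ∈ faces, f.head? = f.getLast?
  face_length : ∀ f ∈ faces, f.length ≤ ρ + 1
  exact : ∀ c : V → V → ℤˣ, (∀ a b, c a b = c b a) → (∀ f ∈ faces, along c f = 1) →
    ∃ g : V → ℤˣ, ∀ a b, adj a b → c a b = g a * g b
  euler : ∀ ℓ : V → ℕ, changes ℓ walk + (faces.map fun f => changes ℓ f - 2).sum + 2 ≤
    2 * Module.finrank ℚ (monoSpace adj ℓ)
  fill : ∀ φ : V → V → FreeGroup α, (∀ a b, φ a b * φ b a = 1) →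
    IsConjProductLE {g | ∃ f ∈ faces, along φ f = g} (faces.countP fun f => along φ f ≠ 1)
      (along φ walk)

/-- The diagram with one vertex. -/
theorem Diagram.nonempty_nil (y : α → G) (ρ : ℕ) : Nonempty (Diagram y ρ [] 0) := by
  refine ⟨{
    V := Unit
    finite := inferInstance
    adj := fun _ _ => False
    pos := fun _ => 1
    walk := [()]
    faces := []
    symm := by simp
    adj_pos := by simp
    conn := fun a b => .refl
    spells := ⟨(), rfl⟩
    closed := rfl
    faces_length := by simp
    face_chain := by simp
    face_closed := by simp
    face_length := by simp
    exact := by simp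
    euler := fun ℓ => ?_
    fill := fun φ _ => by simpa [along] using IsConjProductLE.one _ }⟩
  have : monoSpace (fun _ _ : Unit => False) ℓ = ⊤ := by
    ext h; simp [monoSpace]
  simp [changes, this]

/-- Adding a pendant edge, traversed back and forth by the boundary walk. -/
theorem Diagram.nonempty_insert {y : α → G} {ρ : ℕ} {u v : List (α × Bool)} {A : ℕ}
    (D : Diagram y ρ (u ++ v) A) (a : α × Bool) :
    Nonempty (Diagram y ρ (u ++ [a, (a.1, !a.2)] ++ v) A) := by
  classical
  obtain ⟨P, x, S, hw, h1, h2⟩ := D.spells.exists_of_append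
  have := D.finite
  let adj' : Option D.V → Option D.V → Prop := fun b c =>
    (∃ b' c', b = some b' ∧ c = some c' ∧ D.adj b' c') ∨ (b = none ∧ c = some x) ∨
      (b = some x ∧ c = none)
  let pos' : Option D.V → G := fun b => b.elim (D.pos x * letterValue y a) D.pos
  have hadj : ∀ b c, D.adj b c → adj' (some b) (some c) := fun b c h =>
    Or.inl ⟨b, c, rfl, rfl, h⟩
  have hsymm : ∀ b c, adj' b c → adj' c b := by
    rintro b c (⟨b', c', rfl, rfl, h⟩ | ⟨rfl, rfl⟩ | ⟨rfl, rfl⟩)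
    · exact hadj _ _ (D.symm _ _ h)
    · exact Or.inr (Or.inr ⟨rfl, rfl⟩)
    · exact Or.inr (Or.inl ⟨rfl, rfl⟩)
  have hinv : letterValue y (a.1, !a.2) = (letterValue y a)⁻¹ := by
    rcases a with ⟨a, _ | _⟩ <;> simp [letterValue]
  have hwalk : (P.map some ++ some x :: none :: some x :: S.map some) =
      (P.map some ++ some x :: ([none] ++ some x :: S.map some)) := by simp
  refine ⟨{
    V := Option D.V
    finite := inferInstance
    adj := adj'
    pos := pos'
    walk := P.map some ++ some x :: none :: some x :: S.map some
    faces := D.faces.map (List.map some)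
    symm := hsymm
    adj_pos := ?_
    conn := ?_
    spells := ?_
    closed := ?_
    faces_length := by simpa using D.faces_length
    face_chain := ?_
    face_closed := ?_
    face_length := ?_
    exact := ?_
    euler := ?_
    fill := ?_ }⟩
  · rintro b c (⟨b', c', rfl, rfl, h⟩ | ⟨rfl, rfl⟩ | ⟨rfl, rfl⟩)
    · exact D.adj_pos _ _ h
    · exact ⟨(a.1, !a.2), by simp [pos', hinv]⟩
    · exact ⟨a, by simp [pos']⟩
  · have key : ∀ b, Relation.ReflTransGen adj' b (some x) ∧
        Relation.ReflTransGen adj' (some x) b := by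
      rintro (_ | b)
      · exact ⟨.single (Or.inr (Or.inl ⟨rfl, rfl⟩)), .single (Or.inr (Or.inr ⟨rfl, rfl⟩))⟩
      · exact ⟨(D.conn b x).lift some hadj, (D.conn x b).lift some hadj⟩
    exact fun b c => (key b).1.trans (key c).2
  · have e1 : Spells y adj' pos' u (P.map some ++ [some x]) := by
      simpa using h1.map (q := some) (pos' := pos') hadj (fun _ => rfl)
    have e2 : Spells y adj' pos' v (some x :: S.map some) := by
      simpa using h2.map (q := some) (pos' := pos') hadj (fun _ => rfl)
    rw [List.append_assoc]
    refine e1.append ⟨Or.inr (Or.inr ⟨rfl, rfl⟩), rfl, Or.inr (Or.inl ⟨rfl, rfl⟩), ?_, e2⟩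
    simp [pos', hinv]
  · have h := D.closed
    rw [hw] at h
    have h' := congrArg (Option.map some) h
    rcases P with _ | ⟨p, P⟩ <;> rcases List.eq_nil_or_concat' S with rfl | ⟨S, s, rfl⟩ <;>
      simp [List.getLast?_cons] at h' ⊢ <;> simp [h']
  · intro f hf
    obtain ⟨f, hf', rfl⟩ := List.mem_map.1 hf
    exact List.isChain_map_of_isChain some hadj (D.face_chain f hf')
  · intro f hf
    obtain ⟨f, hf', rfl⟩ := List.mem_map.1 hf
    simp [D.face_closed f hf']
  · intro f hf
    obtain ⟨f, hf', rfl⟩ := List.mem_map.1 hf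
    simpa using D.face_length f hf'
  · intro c hc hf
    obtain ⟨g, hg⟩ := D.exact (fun a b => c (some a) (some b)) (fun a b => hc _ _) fun f hf' => by
      rw [← along_map]
      exact hf _ (List.mem_map_of_mem hf')
    refine ⟨fun b => b.elim (g x * c (some x) none) g, ?_⟩
    rintro b d (⟨b', d', rfl, rfl, h⟩ | ⟨rfl, rfl⟩ | ⟨rfl, rfl⟩)
    · exact hg _ _ h
    · simp [mul_right_comm, Int.units_mul_self, hc none]
    · simp [← mul_assoc, Int.units_mul_self]
  · intro ℓ
    have hE := D.euler (ℓ ∘ some)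
    have e1 : changes ℓ (P.map some ++ some x :: none :: some x :: S.map some) =
        changes (ℓ ∘ some) D.walk + (if ℓ (some x) = ℓ none then 0 else 2) := by
      rw [hw, hwalk, changes_append, changes_append (ℓ ∘ some), List.cons_append,
        List.nil_append]
      have a1 : changes ℓ (P.map some ++ [some x]) = changes (ℓ ∘ some) (P ++ [x]) := by
        rw [← changes_map]; simp
      have a2 : changes ℓ (some x :: S.map some) = changes (ℓ ∘ some) (x :: S) := by
        rw [← changes_map]; simp
      rw [a1]
      simp only [changes, a2]
      by_cases h : ℓ (some x) = ℓ none
      · simp [h]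
      · have h' : ℓ none ≠ ℓ (some x) := fun e => h e.symm
        simp [h, h']; omega
    have e2 : ((D.faces.map (List.map some)).map fun f => changes ℓ f - 2) =
        (D.faces.map fun f => changes (ℓ ∘ some) f - 2) := by
      rw [List.map_map]
      exact List.map_congr_left fun f _ => by simp [changes_map]
    rw [e1, e2]
    by_cases h : ℓ (some x) = ℓ none
    · let T : monoSpace D.adj (ℓ ∘ some) →ₗ[ℚ] monoSpace adj' ℓ :=
        { toFun := fun k => ⟨fun b => b.elim (k.1 x) k.1, by
            rintro b d (⟨b', d', rfl, rfl, h⟩ | ⟨rfl, rfl⟩ | ⟨rfl, rfl⟩) hl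
            · exact k.2 _ _ h hl
            · rfl
            · rfl⟩
          map_add' := fun k k' => by ext (_ | b) <;> rfl
          map_smul' := fun c k => by ext (_ | b) <;> rfl }
      have hT : Function.Injective T := fun k k' hk => by
        ext b
        exact congrFun (congrArg Subtype.val hk) (some b)
      have := LinearMap.finrank_le_finrank_of_injective hT
      rw [if_pos h]
      omega
    · let T : (monoSpace D.adj (ℓ ∘ some) × ℚ) →ₗ[ℚ] monoSpace adj' ℓ :=
        { toFun := fun k => ⟨fun b => b.elim k.2 k.1.1, by
            rintro b d (⟨b', d', rfl, rfl, h'⟩ | ⟨rfl, rfl⟩ | ⟨rfl, rfl⟩) hl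
            · exact k.1.2 _ _ h' hl
            · exact absurd hl.symm h
            · exact absurd hl h⟩
          map_add' := fun k k' => by ext (_ | b) <;> rfl
          map_smul' := fun c k => by ext (_ | b) <;> rfl }
      have hT : Function.Injective T := fun k k' hk => by
        have hk' := congrArg Subtype.val hk
        refine Prod.ext ?_ (congrFun hk' none)
        ext b
        exact congrFun hk' (some b)
      have := LinearMap.finrank_le_finrank_of_injective hT
      rw [Module.finrank_prod, Module.finrank_self] at this
      rw [if_neg h]
      omega
  · intro φ hφ
    have hF := D.fill (fun a b => φ (some a) (some b)) fun a b => hφ _ _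
    have e1 : along φ (P.map some ++ some x :: none :: some x :: S.map some) =
        along (fun a b => φ (some a) (some b)) D.walk := by
      rw [hw, along_append, along_append (fun a b => φ (some a) (some b)), ← along_map φ some,
        ← along_map φ some]
      simp only [along, List.map_append, List.map_cons, List.map_nil]
      rw [← mul_assoc (φ (some x) none), hφ, one_mul]
    rw [e1, List.countP_map]
    have e2 : ((fun f => decide (along φ f ≠ 1)) ∘ List.map some) =
        fun f => decide (along (fun a b => φ (some a) (some b)) f ≠ 1) := by
      funext f
      simp only [Function.comp, along_map]
    rw [e2]
    refine hF.mono ?_ le_rfl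
    rintro g ⟨f, hf, rfl⟩
    exact ⟨_, List.mem_map_of_mem hf, along_map _ _ _⟩

open Classical in
/-- Identifying two vertices lowers the dimension of `monoSpace` by at most one, and preserves it
if all the functions in this space agree at these vertices. -/
theorem finrank_monoSpace_le_of_glue {V V' : Type} [Finite V] [Finite V'] {adj : V → V → Prop}
    {adj' : V' → V' → Prop} {q : V → V'} {x x' : V}
    (hlift : ∀ h : V → ℚ, h x = h x' → ∃ h' : V' → ℚ, ∀ a, h' (q a) = h a)
    (hadj : ∀ a b, adj' a b → ∃ c d, q c = a ∧ q d = b ∧ adj c d)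
    (hadj' : ∀ a b, adj a b → adj' (q a) (q b)) (ℓ : V' → ℕ) :
    Module.finrank ℚ (monoSpace adj (ℓ ∘ q)) ≤ Module.finrank ℚ (monoSpace adj' ℓ) +
      if ∀ h ∈ monoSpace adj (ℓ ∘ q), h x = h x' then 0 else 1 := by
  let T : monoSpace adj (ℓ ∘ q) →ₗ[ℚ] ℚ :=
    { toFun := fun h => h.1 x - h.1 x'
      map_add' := fun h k => by
        simp only [Submodule.coe_add, Pi.add_apply]; ring
      map_smul' := fun c k => by
        simp only [Submodule.coe_smul, Pi.smul_apply, smul_eq_mul, RingHom.id_apply]; ring }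
  let E : monoSpace adj' ℓ →ₗ[ℚ] monoSpace adj (ℓ ∘ q) :=
    { toFun := fun h => ⟨h.1 ∘ q, fun a b hab hl => h.2 _ _ (hadj' _ _ hab) hl⟩
      map_add' := fun h k => rfl
      map_smul' := fun c k => rfl }
  have hker : LinearMap.ker T ≤ LinearMap.range E := by
    intro h hh
    have hx : h.1 x = h.1 x' := sub_eq_zero.1 (LinearMap.mem_ker.1 hh)
    obtain ⟨h', hh'⟩ := hlift h.1 hx
    refine ⟨⟨h', fun a b hab hl => ?_⟩, ?_⟩
    · obtain ⟨c, d, rfl, rfl, hcd⟩ := hadj a b hab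
      rw [hh', hh']
      exact h.2 _ _ hcd hl
    · ext a
      exact hh' a
  have h1 := Submodule.finrank_mono hker
  have h2 := LinearMap.finrank_range_le E
  have h3 := LinearMap.finrank_range_add_finrank_ker T
  split_ifs with hT
  · have h4 : LinearMap.range T = ⊥ := by
      rw [LinearMap.range_eq_bot]
      ext h
      exact sub_eq_zero.2 (hT h.1 h.2)
    rw [h4, finrank_bot] at h3
    omega
  · have h4 := Submodule.finrank_le (LinearMap.range T)
    rw [Module.finrank_self] at h4
    omega

open Classical in
/-- Cutting a subword `r` with trivial value out of the boundary word, by identifying the ends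
of the corresponding part of the boundary walk. This closes up a cell with boundary `r`, unless
`r` has length two and the identification folds two edges together. -/
theorem Diagram.nonempty_glue {y : α → G} {ρ : ℕ} {w₁ r w₂ : List (α × Bool)} {A B : ℕ}
    (D : Diagram y ρ (w₁ ++ r ++ w₂) A) (hr : FreeGroup.lift y (FreeGroup.mk r) = 1)
    (hB : (r.length = 2 ∧ A ≤ B) ∨ (r ≠ [] ∧ r.length ≤ ρ ∧ A + 1 ≤ B)) :
    Nonempty (Diagram y ρ (w₁ ++ w₂) B) := by
  have hr0 : r ≠ [] := by
    rintro rfl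
    simp at hB
  obtain ⟨P, x, u, x', S, hw, h1, hu, h2⟩ := D.spells.exists_of_append_append hr0
  have := D.finite
  let V' := Quot fun a b : D.V => a = x ∧ b = x'
  let q : D.V → V' := Quot.mk _
  have hq : Function.Surjective q := Quot.mk_surjective
  have : Finite V' := Finite.of_surjective q hq
  have hx : q x = q x' := Quot.sound ⟨rfl, rfl⟩
  have hlift : ∀ {X : Type _} (h : D.V → X), h x = h x' → ∃ h' : V' → X, ∀ a, h' (q a) = h a :=
    fun h hxx => ⟨Quot.lift h (by rintro a b ⟨rfl, rfl⟩; exact hxx), fun a => rfl⟩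
  have hpos : D.pos x = D.pos x' := by rw [hu.pos_eq, hr, mul_one]
  obtain ⟨pos', hpos'⟩ : ∃ h' : V' → G, ∀ a, h' (q a) = D.pos a :=
    ⟨Quot.lift D.pos (by rintro a b ⟨rfl, rfl⟩; exact hpos), fun a => rfl⟩
  let adj' : V' → V' → Prop := fun a b => ∃ c d, q c = a ∧ q d = b ∧ D.adj c d
  have hadj : ∀ a b, D.adj a b → adj' (q a) (q b) := fun a b h => ⟨a, b, rfl, rfl, h⟩
  let F : List V' := (x :: u ++ [x']).map q
  obtain ⟨fs, hfs⟩ : ∃ fs : List (List V'),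
      (fs = [] ∧ (∃ z, u = [z]) ∧ A ≤ B) ∨ (fs = [F] ∧ u.length + 1 ≤ ρ ∧ A + 1 ≤ B) := by
    have hlen := hu.length
    rcases hB with ⟨h, h'⟩ | ⟨-, h, h'⟩
    · refine ⟨[], Or.inl ⟨rfl, ?_, h'⟩⟩
      rw [← List.length_eq_one_iff]
      simp at hlen
      omega
    · refine ⟨[F], Or.inr ⟨rfl, ?_, h'⟩⟩
      simp at hlen
      omega
  have hfsF : ∀ f ∈ fs, f = F ∧ u.length + 1 ≤ ρ := by
    rintro f hf
    rcases hfs with ⟨rfl, -⟩ | ⟨rfl, h, -⟩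
    · simp at hf
    · exact ⟨by simpa using hf, h⟩
  have hF : F.head? = F.getLast? := by
    simp [F, List.getLast?_cons, hx]
  refine ⟨{
    V := V'
    finite := inferInstance
    adj := adj'
    pos := pos'
    walk := (P ++ x :: S).map q
    faces := D.faces.map (List.map q) ++ fs
    symm := ?_
    adj_pos := ?_
    conn := ?_
    spells := ?_
    closed := ?_
    faces_length := ?_
    face_chain := ?_
    face_closed := ?_
    face_length := ?_
    exact := ?_
    euler := ?_
    fill := ?_ }⟩
  · rintro _ _ ⟨c, d, rfl, rfl, h⟩
    exact hadj _ _ (D.symm _ _ h)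
  · rintro _ _ ⟨c, d, rfl, rfl, h⟩
    rw [hpos', hpos']
    exact D.adj_pos _ _ h
  · intro a b
    obtain ⟨a, rfl⟩ := hq a
    obtain ⟨b, rfl⟩ := hq b
    exact (D.conn a b).lift q hadj
  · have e1 := h1.map (q := q) (pos' := pos') hadj hpos'
    have e2 := h2.map (q := q) (pos' := pos') hadj hpos'
    rw [List.map_append, List.map_cons] at e1 ⊢
    rw [List.map_cons, ← hx] at e2
    exact e1.append e2
  · have h := congrArg (Option.map q) D.closed
    rw [hw] at h
    rcases P with _ | ⟨p, P⟩ <;> rcases List.eq_nil_or_concat' S with rfl | ⟨S, s, rfl⟩ <;>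
      simp [List.getLast?_cons] at h ⊢ <;> simp [h, hx]
  · have := D.faces_length
    rcases hfs with ⟨rfl, -, h⟩ | ⟨rfl, -, h⟩ <;> simp <;> omega
  · intro f hf
    rcases List.mem_append.1 hf with hf | hf
    · obtain ⟨f, hf', rfl⟩ := List.mem_map.1 hf
      exact List.isChain_map_of_isChain q hadj (D.face_chain f hf')
    · rw [(hfsF f hf).1]
      exact List.isChain_map_of_isChain q hadj hu.isChain
  · intro f hf
    rcases List.mem_append.1 hf with hf | hf
    · obtain ⟨f, hf', rfl⟩ := List.mem_map.1 hf
      simp [D.face_closed f hf']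
    · rw [(hfsF f hf).1]
      exact hF
  · intro f hf
    rcases List.mem_append.1 hf with hf | hf
    · obtain ⟨f, hf', rfl⟩ := List.mem_map.1 hf
      simpa using D.face_length f hf'
    · rw [(hfsF f hf).1]
      have := (hfsF f hf).2
      simp [F]
      omega
  · intro c hc hcf
    obtain ⟨g, hg⟩ := D.exact (fun a b => c (q a) (q b)) (fun a b => hc _ _) fun f hf' => by
      rw [← along_map]
      exact hcf _ (List.mem_append_left _ (List.mem_map_of_mem hf'))
    -- The part cut out of the boundary is closed for `c`, so `g` has equal values at its ends.
    have h3 : along (fun a b => c (q a) (q b)) (x :: u ++ [x']) = 1 := by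
      rcases hfs with ⟨-, ⟨z, rfl⟩, -⟩ | ⟨rfl, -, -⟩
      · simp [along, ← hx, hc (q z), Int.units_mul_self]
      · rw [← along_map]
        exact hcf F (by simp)
    rw [along_eq_of_potential hg x u x' hu.isChain] at h3
    have h4 : g x = g x' := by
      rw [mul_eq_one_iff_eq_inv.1 h3, Int.units_inv_eq_self]
    obtain ⟨g', hg'⟩ := hlift g h4
    refine ⟨g', ?_⟩
    rintro _ _ ⟨a, b, rfl, rfl, h⟩
    rw [hg', hg']
    exact hg _ _ h
  · intro ℓ
    have hE := D.euler (ℓ ∘ q)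
    have hG := finrank_monoSpace_le_of_glue (adj' := adj') (x := x) (x' := x') hlift
      (fun _ _ h => h) hadj ℓ
    have e0 : D.walk = P ++ x :: (u ++ x' :: S) := hw
    have e1 : changes (ℓ ∘ q) D.walk =
        changes ℓ ((P ++ x :: S).map q) + changes (ℓ ∘ q) (x :: u ++ [x']) := by
      have e2 : changes (ℓ ∘ q) (x' :: S) = changes (ℓ ∘ q) (x :: S) := by
        rw [← changes_map, ← changes_map, List.map_cons, ← hx, List.map_cons]
      rw [e0, changes_append, ← List.cons_append, changes_append _ (x :: u), e2, changes_map,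
        changes_append _ P x S]
      omega
    have e3 : ((D.faces.map (List.map q)).map fun f => changes ℓ f - 2) =
        (D.faces.map fun f => changes (ℓ ∘ q) f - 2) := by
      rw [List.map_map]
      exact List.map_congr_left fun f _ => by simp [changes_map]
    rw [List.map_append (f := fun f => changes ℓ f - 2), List.sum_append, e3]
    have h5 : (fs.map fun f => changes ℓ f - 2).sum ≤ changes (ℓ ∘ q) (x :: u ++ [x']) - 2 := by
      rcases hfs with ⟨rfl, -⟩ | ⟨rfl, -⟩
      · simp
      · rw [List.map_singleton, List.sum_singleton, changes_map]
    have h6 : changes (ℓ ∘ q) (x :: u ++ [x']) ≠ 1 := fun h =>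
      label_ne_of_changes_eq_one x u x' h (congrArg ℓ hx)
    by_cases h7 : changes (ℓ ∘ q) (x :: u ++ [x']) = 0
    · have h8 : ∀ h ∈ monoSpace D.adj (ℓ ∘ q), h x = h x' := fun h hh =>
        eq_of_changes_eq_zero hh x u x' hu.isChain h7
      rw [if_pos h8] at hG
      omega
    · have : (if ∀ h ∈ monoSpace D.adj (ℓ ∘ q), h x = h x' then 0 else 1) ≤ 1 := by
        split_ifs <;> simp
      omega
  · intro φ hφ
    have hFill := D.fill (fun a b => φ (q a) (q b)) fun a b => hφ _ _
    set ψ : D.V → D.V → FreeGroup α := fun a b => φ (q a) (q b) with hψ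
    have e2 : along ψ (x' :: S) = along ψ (x :: S) := by
      rw [hψ, ← along_map φ q, ← along_map φ q, List.map_cons, ← hx, List.map_cons]
    have e0 : along ψ D.walk =
        along ψ (P ++ [x]) * along ψ (x :: u ++ [x']) * along ψ (x :: S) := by
      rw [hw, along_append, ← List.cons_append, along_append _ (x :: u), e2, mul_assoc]
    have e1 : along φ ((P ++ x :: S).map q) = along ψ (P ++ [x]) * along ψ (x :: S) := by
      rw [along_map, ← hψ, along_append]
    have e4 : along φ ((P ++ x :: S).map q) =
        along ψ (P ++ [x]) * (along ψ (x :: u ++ [x']))⁻¹ * (along ψ (P ++ [x]))⁻¹ *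
          along ψ D.walk := by
      rw [e1, e0]
      group
    have e5 : ((fun f => decide (along φ f ≠ 1)) ∘ List.map q) =
        fun f => decide (along ψ f ≠ 1) := by
      funext f
      simp only [Function.comp, along_map, hψ]
    rw [List.countP_append, List.countP_map, e5, e4, add_comm]
    refine IsConjProductLE.mul ?_ (hFill.mono ?_ le_rfl)
    · by_cases h8 : along ψ (x :: u ++ [x']) = 1
      · rw [h8]
        simpa using (IsConjProductLE.one _).mono subset_rfl (Nat.zero_le _)
      · refine IsConjProductLE.conj (IsConjProductLE.inv ?_) _
        have h9 : along φ F = along ψ (x :: u ++ [x']) := along_map _ _ _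
        rcases hfs with ⟨-, ⟨z, rfl⟩, -⟩ | ⟨rfl, -, -⟩
        · exact absurd (by simp [along, hψ, ← hx, hφ]) h8
        · refine (IsConjProductLE.of_mem ?_).mono subset_rfl ?_
          · exact ⟨F, by simp, h9⟩
          · simp only [List.countP_singleton, h9, ne_eq, h8, not_false_eq_true, decide_true,
              if_true, le_refl]
    · rintro g ⟨f, hf, rfl⟩
      exact ⟨_, List.mem_append_left _ (List.mem_map_of_mem hf), along_map _ _ _⟩

/-- Words which can be reduced to the empty word by inserting and deleting pairs of inverse
letters and by deleting `A` relators of length at most `ρ`. -/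
inductive Fillable (y : α → G) (ρ : ℕ) : List (α × Bool) → ℕ → Prop
  | nil : Fillable y ρ [] 0
  | insert {u v : List (α × Bool)} {A : ℕ} (a : α × Bool) (h : Fillable y ρ (u ++ v) A) :
    Fillable y ρ (u ++ [a, (a.1, !a.2)] ++ v) A
  | cancel {u v : List (α × Bool)} {A : ℕ} (a : α × Bool)
    (h : Fillable y ρ (u ++ [a, (a.1, !a.2)] ++ v) A) : Fillable y ρ (u ++ v) A
  | relator {u r v : List (α × Bool)} {A : ℕ} (hr : FreeGroup.lift y (FreeGroup.mk r) = 1)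
    (hρ : r.length ≤ ρ) (h : Fillable y ρ (u ++ r ++ v) A) : Fillable y ρ (u ++ v) (A + 1)

theorem Fillable.nonempty_diagram {y : α → G} {ρ A : ℕ} {w : List (α × Bool)}
    (h : Fillable y ρ w A) : Nonempty (Diagram y ρ w A) := by
  induction h with
  | nil => exact Diagram.nonempty_nil y ρ
  | insert a _ ih => exact ih.elim fun D => D.nonempty_insert a
  | cancel a _ ih =>
    refine ih.elim fun D => D.nonempty_glue ?_ (Or.inl ⟨rfl, le_rfl⟩)
    rcases a with ⟨a, _ | _⟩ <;> simp [FreeGroup.lift_mk]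
  | @relator u r v A hr hρ _ ih =>
    rcases eq_or_ne r [] with rfl | hr0
    · refine ih.elim fun D => ⟨?_⟩
      rw [List.append_nil] at D
      exact { D with faces_length := D.faces_length.trans (Nat.le_succ _) }
    · exact ih.elim fun D => D.nonempty_glue hr (Or.inr ⟨hr0, hρ, le_rfl⟩)

theorem Fillable.of_red {y : α → G} {ρ A : ℕ} {v w : List (α × Bool)}
    (h : FreeGroup.Red v w) : Fillable y ρ v A ↔ Fillable y ρ w A := by
  induction h with
  | refl => rfl
  | tail _ h ih =>
    rw [ih]
    obtain ⟨L, M, a, b⟩ := FreeGroup.Red.Step.casesOn (motive := fun v w _ =>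
      ∃ L M a b, v = L ++ (a, b) :: (a, !b) :: M ∧ w = L ++ M) h
      (fun {L M a b} => ⟨L, M, a, b, rfl, rfl⟩)
    obtain ⟨b, rfl, rfl⟩ := b
    exact ⟨fun h => .cancel (a, b) (by simpa using h),
      fun h => by simpa using Fillable.insert (a, b) h⟩

theorem Fillable.congr {y : α → G} {ρ A : ℕ} {v w : List (α × Bool)} (h : Fillable y ρ v A)
    (hvw : FreeGroup.mk v = FreeGroup.mk w) : Fillable y ρ w A := by
  obtain ⟨c, h1, h2⟩ := FreeGroup.Red.exact.1 hvw
  exact (Fillable.of_red h2).2 ((Fillable.of_red h1).1 h)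

theorem fillable_of_isConjProduct [DecidableEq α] {y : α → G} {ρ : ℕ} {R : Set (FreeGroup α)}
    (hR : ∀ r ∈ R, r.toWord.length ≤ ρ ∧ FreeGroup.lift y r = 1) {w : FreeGroup α} {A : ℕ}
    (h : IsConjProduct R w A) : Fillable y ρ w.toWord A := by
  obtain ⟨L, rfl, hL, rfl⟩ := h
  induction L with
  | nil => simpa using Fillable.nil
  | cons g L ih =>
    have h1 := ih fun g hg => hL g (by simp [hg])
    obtain ⟨f, r, hr, hg⟩ := hL g (by simp)
    obtain ⟨s, hs, hsl, hgs⟩ : ∃ s : FreeGroup α, FreeGroup.lift y s = 1 ∧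
        s.toWord.length ≤ ρ ∧ g = f⁻¹ * s * f := by
      rcases hg with rfl | rfl
      · exact ⟨r, (hR r hr).2, (hR r hr).1, rfl⟩
      · refine ⟨r⁻¹, by simp [(hR r hr).2], ?_, rfl⟩
        rw [← FreeGroup.norm, FreeGroup.norm_inv_eq]
        exact (hR r hr).1
    -- Insert `f⁻¹ s s⁻¹ f`, which is trivial in the free group, and cut `s⁻¹` out.
    have h2 : Fillable y ρ ((f⁻¹.toWord ++ s.toWord) ++ s⁻¹.toWord ++
        (f.toWord ++ L.prod.toWord)) L.length := by
      refine h1.congr ?_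
      simp only [← FreeGroup.mul_mk, FreeGroup.mk_toWord]
      group
    have h3 := h2.relator (by rw [FreeGroup.mk_toWord]; simp [hs])
      (by rw [← FreeGroup.norm, FreeGroup.norm_inv_eq]; exact hsl)
    refine h3.congr ?_
    simp only [← FreeGroup.mul_mk, FreeGroup.mk_toWord, hgs, List.prod_cons]
    group

end Diagrams

/-! ### Hulls in graphs -/

section Hulls

variable {V : Type*} (Γ : SimpleGraph V) (W : Set V)

/-- The vertices which can be joined to `W` by a path avoiding `B`. -/
def outside (B : Set V) : Set V :=
  {v | ∃ w ∈ W, w ∉ B ∧ Relation.ReflTransGen (fun a b => Γ.Adj a b ∧ a ∉ B ∧ b ∉ B) v w}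

/-- The set `B` together with the components of its complement which do not meet `W`. -/
def hull (B : Set V) : Set V := (outside Γ W B)ᶜ

variable {Γ W} {B B' : Set V}

theorem mem_outside_of_mem {w : V} (hw : w ∈ W) (h : w ∉ B) : w ∈ outside Γ W B :=
  ⟨w, hw, h, .refl⟩

theorem mem_outside_of_adj {u v : V} (hv : v ∈ outside Γ W B) (h : Γ.Adj u v) (hu : u ∉ B)
    (hvB : v ∉ B) : u ∈ outside Γ W B := by
  obtain ⟨w, hw, hwB, hr⟩ := hv
  exact ⟨w, hw, hwB, .head ⟨h, hu, hvB⟩ hr⟩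

theorem notMem_of_mem_outside {v : V} (hv : v ∈ outside Γ W B) : v ∉ B := by
  obtain ⟨w, hw, hwB, hr⟩ := hv
  rcases hr.cases_head with rfl | ⟨c, hc, -⟩
  · exact hwB
  · exact hc.2.1

theorem subset_hull : B ⊆ hull Γ W B := fun _ hv hv' => notMem_of_mem_outside hv' hv

theorem outside_induction {P : V → Prop} (h1 : ∀ w ∈ W, w ∉ B → P w)
    (h2 : ∀ u v, Γ.Adj u v → u ∈ outside Γ W B → v ∈ outside Γ W B → P v → P u) {v : V}
    (hv : v ∈ outside Γ W B) : P v := by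
  obtain ⟨w, hw, hwB, hr⟩ := hv
  induction hr using Relation.ReflTransGen.head_induction_on with
  | refl => exact h1 w hw hwB
  | head h h' ih => exact h2 _ _ h.1 ⟨w, hw, hwB, .head h h'⟩ ⟨w, hw, hwB, h'⟩ ih

theorem hull_subset_hull (h : B' ⊆ hull Γ W B) : hull Γ W B' ⊆ hull Γ W B := by
  refine Set.compl_subset_compl.2 fun v hv => ?_
  have key : ∀ u ∈ outside Γ W B, u ∉ B' := fun u hu hu' => h hu' hu
  exact outside_induction
    (fun w hw hwB => mem_outside_of_mem hw (key _ (mem_outside_of_mem hw hwB)))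
    (fun u v huv hu hv hv' => mem_outside_of_adj hv' huv (key u hu) (key v hv)) hv

/-- A set which contains the part of `W` and the boundary vertices of a hull has a larger hull. -/
theorem hull_subset_hull_of_mouth (hW : ∀ p ∈ hull Γ W B, p ∈ W → p ∈ B')
    (h : ∀ p ∈ hull Γ W B, ∀ o ∈ outside Γ W B, Γ.Adj p o → p ∈ B') :
    hull Γ W B ⊆ hull Γ W B' := by
  refine Set.compl_subset_compl.2 fun v hv => ?_
  refine outside_induction (P := fun v => v ∈ outside Γ W B) (fun w hw hwB => ?_)
    (fun u v huv hu hv hv' => ?_) hv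
  · by_contra hn
    exact hwB (hW w hn hw)
  · by_contra hn
    exact notMem_of_mem_outside hu (h u hn v hv' huv)

theorem mem_of_adj_outside {p o : V} (ho : o ∈ outside Γ W B) (h : Γ.Adj p o)
    (hp : p ∈ hull Γ W B) : p ∈ B := by
  by_contra hn
  exact hp (mem_outside_of_adj ho h hn (notMem_of_mem_outside ho))

theorem exists_adj_dist_succ (hΓ : Γ.Connected) {z v : V} (h : v ≠ z) :
    ∃ u, Γ.Adj v u ∧ Γ.dist z u + 1 = Γ.dist z v := by
  obtain ⟨p, hp⟩ := hΓ.exists_walk_length_eq_dist v z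
  cases p with
  | nil => exact absurd rfl h
  | @cons _ u _ huv p =>
    refine ⟨u, huv, ?_⟩
    have h1 := SimpleGraph.dist_le p
    have h2 := hΓ.dist_triangle (u := v) (v := u) (w := z)
    rw [SimpleGraph.dist_eq_one_iff_adj.2 huv] at h2
    rw [SimpleGraph.Walk.length_cons] at hp
    rw [SimpleGraph.dist_comm, SimpleGraph.dist_comm (u := z)]
    omega

theorem dist_le_succ_of_adj (hΓ : Γ.Connected) {z u v : V} (h : Γ.Adj u v) :
    Γ.dist z v ≤ Γ.dist z u + 1 := by
  have := hΓ.dist_triangle (u := z) (v := u) (w := v)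
  rwa [SimpleGraph.dist_eq_one_iff_adj.2 h] at this

/-- The closed ball of radius `t` around `x`. -/
def ball (Γ : SimpleGraph V) (x : V) (t : ℕ) : Set V := {v | Γ.dist x v ≤ t}

end Hulls

/-! ### Connectedness of the boundary of a hull -/

section Mouth

variable {V : Type*} {Γ : SimpleGraph V}

theorem along_congr {M : Type*} [Monoid M] {φ ψ : V → V → M} {f : List V}
    (h : ∀ a b, [a, b] <:+: f → φ a b = ψ a b) : along φ f = along ψ f := by
  induction f with
  | nil => rfl
  | cons a f ih =>
    cases f with
    | nil => rfl
    | cons b f =>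
      simp only [along]
      rw [h a b ⟨[], f, by simp⟩, ih fun c d hcd => h c d (hcd.trans (List.suffix_cons _ _).isInfix)]

theorem along_inv_mul {M : Type*} [Group M] (s : V → M) (x : V) (u : List V) (y : V) :
    along (fun a b => (s a)⁻¹ * s b) (x :: u ++ [y]) = (s x)⁻¹ * s y := by
  induction u generalizing x with
  | nil => simp [along]
  | cons z u ih =>
    have := ih z
    simp only [List.cons_append, along] at this ⊢
    rw [this, mul_assoc, mul_inv_cancel_left]

theorem along_inv_mul_of_closed {M : Type*} [Group M] (s : V → M) {f : List V}
    (hf : f.head? = f.getLast?) : along (fun a b => (s a)⁻¹ * s b) f = 1 := by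
  rcases f with _ | ⟨x, f⟩
  · rfl
  · rcases List.eq_nil_or_concat' f with rfl | ⟨u, y, rfl⟩
    · rfl
    · have : x = y := by simpa [List.getLast?_cons] using hf
      rw [← List.cons_append, along_inv_mul, this, inv_mul_cancel]

theorem eq_of_mem_chain {X : Type*} {g : V → X} {r : V → V → Prop} {l : List V}
    (hl : l.IsChain r) (h : ∀ a ∈ l, ∀ b ∈ l, r a b → g a = g b) :
    ∀ a ∈ l, ∀ b ∈ l, g a = g b := by
  suffices H : ∀ c l, (c :: l).IsChain r → (∀ a ∈ c :: l, ∀ b ∈ c :: l, r a b → g a = g b) →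
      ∀ a ∈ c :: l, g a = g c by
    cases l with
    | nil => simp
    | cons c l =>
      intro a ha b hb
      rw [H c l hl h a ha, H c l hl h b hb]
  intro c l
  induction l generalizing c with
  | nil => simp
  | cons d l ih =>
    intro hl h a ha
    rw [List.isChain_cons_cons] at hl
    rcases List.mem_cons.1 ha with rfl | ha
    · rfl
    · rw [ih d hl.2 (fun a ha b hb => h a (List.mem_cons_of_mem _ ha) b
        (List.mem_cons_of_mem _ hb)) a ha]
      exact (h c (by simp) d (by simp) hl.1).symm

theorem dist_le_mul_of_reachable {M : Finset V} {ρ : ℕ} (hΓ : Γ.Connected) {p p' : M}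
    (h : (SimpleGraph.fromRel fun a b : M => Γ.dist (a : V) b ≤ ρ).Reachable p p') :
    Γ.dist (p : V) p' ≤ ρ * M.card := by
  classical
  have key : ∀ {a b : M} (w : (SimpleGraph.fromRel fun a b : M => Γ.dist (a : V) b ≤ ρ).Walk a b),
      Γ.dist (a : V) b ≤ ρ * w.length := by
    intro a b w
    induction w with
    | nil => simp
    | @cons a c b hac w ih =>
      rw [SimpleGraph.Walk.length_cons, mul_add, mul_one]
      have h1 := hΓ.dist_triangle (u := (a : V)) (v := c) (w := b)
      have h2 : Γ.dist (a : V) c ≤ ρ := by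
        rcases hac.2 with h | h
        · exact h
        · rwa [SimpleGraph.dist_comm]
      omega
  obtain ⟨w⟩ := h
  refine (key w.toPath.1).trans (Nat.mul_le_mul_left _ ?_)
  have := w.toPath.2.length_lt
  rw [Fintype.card_coe] at this
  exact this.le

/-- A ball which misses the connected set `W`, and whose boundary sphere meets at most `m`
vertices of the faces, has a hull with small boundary: since the first cohomology vanishes, the
edges leaving the hull are linked by faces. -/
theorem dist_le_of_mouth (hΓ : Γ.Connected) {faces : List (List V)} {walk : List V} {ρ m : ℕ}
    (hexact : ∀ c : V → V → ℤˣ, (∀ a b, c a b = c b a) → (∀ f ∈ faces, along c f = 1) →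
      ∃ g : V → ℤˣ, ∀ a b, Γ.Adj a b → c a b = g a * g b)
    (hclosed : ∀ f ∈ faces, f.head? = f.getLast?)
    (hchain : ∀ f ∈ faces, f.IsChain fun a b => a = b ∨ Γ.Adj a b)
    (hdist : ∀ f ∈ faces, ∀ a ∈ f, ∀ b ∈ f, Γ.dist a b ≤ ρ)
    (hwalk : walk.IsChain fun a b => a = b ∨ Γ.Adj a b)
    {F : Finset V} (hF : ∀ f ∈ faces, ∀ v ∈ f, v ∈ F) {x : V} {t : ℕ}
    (hW : ∀ w ∈ walk, w ∉ ball Γ x t) (hm : (F.filter fun v => Γ.dist x v = t).card ≤ m)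
    {p o p' o' : V} (hp : p ∈ hull Γ {w | w ∈ walk} (ball Γ x t))
    (ho : o ∈ outside Γ {w | w ∈ walk} (ball Γ x t)) (hpo : Γ.Adj p o)
    (hp' : p' ∈ hull Γ {w | w ∈ walk} (ball Γ x t))
    (ho' : o' ∈ outside Γ {w | w ∈ walk} (ball Γ x t)) (hpo' : Γ.Adj p' o') :
    Γ.dist p p' ≤ ρ * m := by
  classical
  set Q := hull Γ {w | w ∈ walk} (ball Γ x t) with hQ
  set O := outside Γ {w | w ∈ walk} (ball Γ x t) with hO
  have hQO : ∀ {v}, v ∈ Q → v ∉ O := fun h => h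
  have hOQ : ∀ {v}, v ∉ O → v ∈ Q := fun h => h
  have hsphere : ∀ a ∈ Q, ∀ b ∈ O, Γ.Adj a b → Γ.dist x a = t := by
    intro a ha b hb hab
    have h1 : a ∈ ball Γ x t := mem_of_adj_outside hb hab ha
    have h2 : b ∉ ball Γ x t := notMem_of_mem_outside hb
    have h3 := dist_le_succ_of_adj hΓ (z := x) hab
    simp only [ball, Set.mem_ofPred_eq] at h1 h2
    omega
  let occurs : List V → V × V → Prop := fun f e => [e.1, e.2] <:+: f ∨ [e.2, e.1] <:+: f
  let E : V × V → Prop := fun e => e.1 ∈ Q ∧ e.2 ∈ O ∧ Γ.Adj e.1 e.2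
  let link : V × V → V × V → Prop := fun e e' => E e' ∧ ∃ f ∈ faces, occurs f e ∧ occurs f e'
  let δ : V × V → Prop := Relation.ReflTransGen link (p, o)
  have hδE : ∀ e, δ e → E e := by
    intro e he
    rcases he.cases_tail with rfl | ⟨d, -, hd⟩
    · exact ⟨hp, ho, hpo⟩
    · exact hd.1
  -- The indicator of the edges linked to `(p, o)` is closed, hence exact.
  let c : V → V → ℤˣ := fun a b => if δ (a, b) ∨ δ (b, a) then -1 else 1
  obtain ⟨g, hg⟩ := hexact c (fun a b => by simp only [c, or_comm]) (by
    intro f hf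
    by_cases he : ∃ e, δ e ∧ occurs f e
    · obtain ⟨e, he, hef⟩ := he
      rw [along_congr (ψ := fun a b => (if a ∈ Q then 1 else -1)⁻¹ * (if b ∈ Q then 1 else -1)),
        along_inv_mul_of_closed _ (hclosed f hf)]
      intro a b hab
      have hab' : a = b ∨ Γ.Adj a b := by simpa using (hchain f hf).infix hab
      have hmem : ∀ a' b', a' ∈ Q → b' ∉ Q → occurs f (a', b') → Γ.Adj a' b' → δ (a', b') :=
        fun a' b' ha hb h1 h2 => he.tail ⟨⟨ha, not_not.1 hb, h2⟩, f, hf, hef, h1⟩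
      by_cases ha : a ∈ Q <;> by_cases hb : b ∈ Q
      · have : ¬ (δ (a, b) ∨ δ (b, a)) := by
          rintro (h | h)
          · exact hb (hδE _ h).2.1
          · exact ha (hδE _ h).2.1
        simp [c, this, ha, hb]
      · have hadj : Γ.Adj a b := hab'.resolve_left (by rintro rfl; exact hb ha)
        have : δ (a, b) := hmem a b ha hb (Or.inl hab) hadj
        simp [c, this, ha, hb]
      · have hadj : Γ.Adj a b := hab'.resolve_left (by rintro rfl; exact ha hb)
        have : δ (b, a) := hmem b a hb ha (Or.inr hab) hadj.symm
        simp [c, this, ha, hb]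
      · have : ¬ (δ (a, b) ∨ δ (b, a)) := by
          rintro (h | h)
          · exact ha (hδE _ h).1
          · exact hb (hδE _ h).1
        simp [c, this, ha, hb]
    · rw [along_congr (ψ := fun a b => ((1 : V → ℤˣ) a)⁻¹ * (1 : V → ℤˣ) b),
        along_inv_mul_of_closed _ (hclosed f hf)]
      intro a b hab
      have : ¬ (δ (a, b) ∨ δ (b, a)) := by
        rintro (h | h)
        · exact he ⟨_, h, Or.inl hab⟩
        · exact he ⟨_, h, Or.inr hab⟩
      simp [c, this])
  have hgeq : ∀ a b, Γ.Adj a b → ¬ (δ (a, b) ∨ δ (b, a)) → g a = g b := by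
    intro a b hab hn
    have h1 := hg a b hab
    simp only [c, if_neg hn] at h1
    rw [mul_eq_one_iff_eq_inv.1 h1.symm, Int.units_inv_eq_self]
  have hgQ : ∀ n u, Γ.dist x u = n → u ∈ Q → g u = g x := by
    intro n
    induction n with
    | zero =>
      intro u hu _
      rw [(hΓ.dist_eq_zero_iff.1 hu)]
    | succ n ih =>
      intro u hu huQ
      obtain ⟨v, huv, hv⟩ := exists_adj_dist_succ hΓ (z := x) (v := u) (by
        rintro rfl
        simp at hu)
      have hvQ : v ∈ Q := by
        by_contra hvn
        have hvO : v ∈ O := not_not.1 hvn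
        have h1 : u ∈ ball Γ x t := mem_of_adj_outside hvO huv huQ
        have h2 : v ∉ ball Γ x t := notMem_of_mem_outside hvO
        simp only [ball, Set.mem_ofPred_eq] at h1 h2
        omega
      rw [← ih v (by omega) hvQ]
      refine hgeq u v huv ?_
      rintro (h | h)
      · exact hvQ (hδE _ h).2.1
      · exact huQ (hδE _ h).2.1
  have hgO : ∀ a ∈ O, ∀ b ∈ O, Γ.Adj a b → g a = g b := by
    intro a ha b hb hab
    refine hgeq a b hab ?_
    rintro (h | h)
    · exact (hδE _ h).1 ha
    · exact (hδE _ h).1 hb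
  have hgw : ∀ a ∈ walk, ∀ b ∈ walk, g a = g b := by
    refine eq_of_mem_chain hwalk fun a ha b hb hab => ?_
    rcases hab with rfl | hab
    · rfl
    · exact hgO a (mem_outside_of_mem ha (hW a ha)) b (mem_outside_of_mem hb (hW b hb)) hab
  have hgOw : ∀ a ∈ O, ∀ w ∈ walk, g a = g w := by
    intro a ha
    refine outside_induction (P := fun a => ∀ w ∈ walk, g a = g w)
      (fun w hw _ w' hw' => hgw w hw w' hw') (fun u v huv hu hv hv' w hw => ?_) ha
    rw [hgO u hu v hv huv, hv' w hw]
  have hoo : g o = g o' := by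
    obtain ⟨w, hw, -⟩ := id ho
    rw [hgOw o ho w hw, hgOw o' ho' w hw]
  have hpp : g p = g p' := by rw [hgQ _ p rfl hp, hgQ _ p' rfl hp']
  have hlinked : δ (p', o') := by
    by_contra hn
    have hn' : ¬ (δ (p', o') ∨ δ (o', p')) := by
      rintro (h | h)
      · exact hn h
      · exact (hδE _ h).1 ho'
    have h1 := hg p o hpo
    have h2 := hg p' o' hpo'
    have h3 : δ (p, o) := .refl
    rw [← hpp, ← hoo, ← h1] at h2
    simp [c, hn', h3] at h2
  -- The chain of links is a chain of at most `m` vertices of the sphere.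
  set M := F.filter fun v => Γ.dist x v = t with hM
  have hmemM : ∀ e, E e → ∀ f ∈ faces, occurs f e → e.1 ∈ M ∧ e.1 ∈ f := by
    intro e he f hf hef
    have h1 : e.1 ∈ f := by
      rcases hef with h | h
      · exact h.subset (by simp)
      · exact h.subset (by simp)
    exact ⟨Finset.mem_filter.2 ⟨hF f hf _ h1, hsphere _ he.1 _ he.2.1 he.2.2⟩, h1⟩
  have hreach : ∀ e, δ e → e.1 = p ∨ ∃ (h0 : p ∈ M) (h1 : e.1 ∈ M),
      (SimpleGraph.fromRel fun a b : M => Γ.dist (a : V) b ≤ ρ).Reachable ⟨p, h0⟩ ⟨e.1, h1⟩ := by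
    intro e he
    induction he with
    | refl => exact Or.inl rfl
    | @tail d e hd hde ih =>
      obtain ⟨heE, f, hf, hdf, hef⟩ := hde
      obtain ⟨hdM, hdf⟩ := hmemM d (hδE d hd) f hf hdf
      obtain ⟨heM, hef⟩ := hmemM e heE f hf hef
      have hstep : (SimpleGraph.fromRel fun a b : M => Γ.dist (a : V) b ≤ ρ).Reachable
          ⟨d.1, hdM⟩ ⟨e.1, heM⟩ := by
        by_cases hde : d.1 = e.1
        · rw [show (⟨d.1, hdM⟩ : M) = ⟨e.1, heM⟩ from Subtype.ext hde]
        · refine SimpleGraph.Adj.reachable ⟨fun h => hde (congrArg Subtype.val h), Or.inl ?_⟩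
          exact hdist f hf _ hdf _ hef
      right
      rcases ih with h | ⟨h0, h1, h⟩
      · exact ⟨h ▸ hdM, heM, by simpa [h] using hstep⟩
      · exact ⟨h0, heM, h.trans hstep⟩
  rcases hreach _ hlinked with h | ⟨h0, h1, h⟩
  · simp only at h
    simp [h]
  · exact (dist_le_mul_of_reachable hΓ h).trans (Nat.mul_le_mul_left _ hm)

end Mouth

/-! ### Covering by hulls of balls -/

section Cover

variable {V : Type*} {Γ : SimpleGraph V}

open Classical in
/-- A vertex is good at scale `q` if it is close to the boundary walk, or if the ball of radius
`2 * q` around it contains at least `q * m` of the vertices in `F`. -/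
def IsGood (Γ : SimpleGraph V) (walk : List V) (F : Finset V) (q m : ℕ) (x : V) : Prop :=
  (∃ w ∈ walk, Γ.dist x w ≤ 2 * q) ∨ q * m ≤ (F.filter fun v => Γ.dist x v ≤ 2 * q).card

open Classical in
/-- By the coarea inequality, some ball around a vertex which is not good has a sparse sphere. -/
theorem exists_sphere_card_le {walk : List V} {F : Finset V} {q m : ℕ} {x : V}
    (hx : ¬ IsGood Γ walk F q m x) : ∃ t, q < t ∧ t ≤ 2 * q ∧ (∀ w ∈ walk, w ∉ ball Γ x t) ∧
      (F.filter fun v => Γ.dist x v = t).card ≤ m := by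
  simp only [IsGood, not_or, not_exists, not_and, not_le] at hx
  obtain ⟨h1, h2⟩ := hx
  have h3 : (F.filter fun v => Γ.dist x v ≤ 2 * q).card < (Finset.Ioc q (2 * q)).card * m := by
    rwa [Nat.card_Ioc, show 2 * q - q = q by omega]
  obtain ⟨t, ht, h4⟩ := Finset.exists_card_fiber_lt_of_card_lt_mul
    (f := fun v => Γ.dist x v) h3
  rw [Finset.mem_Ioc] at ht
  refine ⟨t, ht.1, ht.2, fun w hw hwt => ?_, ?_⟩
  · have h5 := h1 w hw
    simp only [ball, Set.mem_ofPred_eq] at hwt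
    omega
  · refine le_trans (Finset.card_le_card fun v hv => ?_) h4.le
    simp only [Finset.mem_filter] at hv ⊢
    exact ⟨⟨hv.1, by omega⟩, hv.2⟩

/-- Every vertex is in the hull of a small ball around a good vertex: take a maximal hull with
small boundary around a vertex which is not good, and a vertex on its boundary. -/
theorem exists_isGood_mem_hull [Finite V] (hΓ : Γ.Connected) {faces : List (List V)}
    {walk : List V} {ρ m : ℕ} (hρ : 0 < ρ * m)
    (hexact : ∀ c : V → V → ℤˣ, (∀ a b, c a b = c b a) → (∀ f ∈ faces, along c f = 1) →
      ∃ g : V → ℤˣ, ∀ a b, Γ.Adj a b → c a b = g a * g b)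
    (hclosed : ∀ f ∈ faces, f.head? = f.getLast?)
    (hchain : ∀ f ∈ faces, f.IsChain fun a b => a = b ∨ Γ.Adj a b)
    (hdist : ∀ f ∈ faces, ∀ a ∈ f, ∀ b ∈ f, Γ.dist a b ≤ ρ)
    (hwalk : walk.IsChain fun a b => a = b ∨ Γ.Adj a b) (hne : walk ≠ [])
    {F : Finset V} (hF : ∀ f ∈ faces, ∀ v ∈ f, v ∈ F) (v : V) :
    ∃ p, IsGood Γ walk F (ρ * m) m p ∧ v ∈ hull Γ {w | w ∈ walk} (ball Γ p (ρ * m)) := by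
  set q := ρ * m with hq
  set W : Set V := {w | w ∈ walk} with hWdef
  have hself : ∀ x t, x ∈ ball Γ x t := fun x t => by simp [ball]
  -- The hulls with small boundary.
  let bubble : Set V → Prop := fun Q => ∃ x t, q < t ∧ Q = hull Γ W (ball Γ x t) ∧
    (∀ w ∈ walk, w ∉ ball Γ x t) ∧ ∀ p ∈ Q, ∀ o ∉ Q, Γ.Adj p o →
      ∀ p' ∈ Q, ∀ o' ∉ Q, Γ.Adj p' o' → Γ.dist p p' ≤ q
  have hbubble : ∀ x, ¬ IsGood Γ walk F q m x → ∃ t, q < t ∧ bubble (hull Γ W (ball Γ x t)) := by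
    intro x hx
    obtain ⟨t, h1, -, h2, h3⟩ := exists_sphere_card_le hx
    refine ⟨t, h1, x, t, h1, rfl, h2, fun p hp o ho hpo p' hp' o' ho' hpo' => ?_⟩
    exact dist_le_of_mouth hΓ hexact hclosed hchain hdist hwalk hF h2 h3 hp (not_not.1 ho) hpo hp'
      (not_not.1 ho') hpo'
  by_cases hv : IsGood Γ walk F q m v
  · exact ⟨v, hv, subset_hull (hself v q)⟩
  obtain ⟨t₀, -, h0⟩ := hbubble v hv
  obtain ⟨Q, -, hQ⟩ := (Set.toFinite {Q : Set V | v ∈ Q ∧ bubble Q}).exists_le_maximal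
    ⟨subset_hull (hself v t₀), h0⟩
  obtain ⟨⟨hvQ, x, t, ht, hQt, hW, hmouth⟩, hmax⟩ := hQ
  obtain ⟨w₀, hw₀⟩ := List.exists_mem_of_ne_nil walk hne
  have hW' : ∀ w ∈ walk, w ∉ Q := by
    intro w hw hwQ
    rw [hQt] at hwQ
    exact hwQ (mem_outside_of_mem hw (hW w hw))
  -- A vertex on the boundary of `Q`.
  obtain ⟨p, hpQ, o, hoQ, hpo⟩ : ∃ p ∈ Q, ∃ o ∉ Q, Γ.Adj p o := by
    obtain ⟨r⟩ := hΓ.preconnected v w₀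
    obtain ⟨d, -, hd1, hd2⟩ := r.exists_boundary_dart Q hvQ (hW' w₀ hw₀)
    exact ⟨d.fst, hd1, d.snd, hd2, d.adj⟩
  have hsub : ∀ t', q ≤ t' → Q ⊆ hull Γ W (ball Γ p t') := by
    intro t' ht'
    rw [hQt]
    refine hull_subset_hull_of_mouth (fun w hw hww => ?_) fun p' hp' o' ho' hpo' => ?_
    · rw [← hQt] at hw
      exact absurd hw (hW' w hww)
    · refine le_trans (hmouth p hpQ o hoQ hpo p' (hQt ▸ hp') o' ?_ hpo') ht'
      rw [hQt]
      exact not_not.2 ho'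
  refine ⟨p, ?_, hsub q le_rfl hvQ⟩
  by_contra hp
  obtain ⟨t', ht', hb⟩ := hbubble p hp
  have h1 := hmax ⟨hsub t' ht'.le hvQ, hb⟩ (hsub t' ht'.le)
  refine hoQ (h1 (subset_hull ?_))
  simp only [ball, Set.mem_ofPred_eq]
  rw [SimpleGraph.dist_eq_one_iff_adj.2 hpo]
  omega

theorem dist_getElem_le (hΓ : Γ.Connected) {l : List V}
    (hl : l.IsChain fun a b => a = b ∨ Γ.Adj a b) {i k : ℕ} (h : i + k < l.length) :
    Γ.dist (l[i]'(by omega)) l[i + k] ≤ k := by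
  induction k with
  | zero => simp
  | succ k ih =>
    have h1 := ih (by omega)
    have h2 := hΓ.dist_triangle (u := l[i]'(by omega)) (v := l[i + k]'(by omega))
      (w := l[i + (k + 1)]'h)
    have h3 : Γ.dist (l[i + k]'(by omega)) (l[i + (k + 1)]'h) ≤ 1 := by
      rcases List.isChain_iff_getElem.1 hl (i + k) (by omega) with h | h
      · rw [show l[i + (k + 1)] = l[i + k] from h.symm]
        simp
      · exact (SimpleGraph.dist_eq_one_iff_adj.2 h).le
    omega

open Classical in
/-- The size of a set of good vertices which are far apart from each other. The balls of radius
`2 * q` around those of the second kind are disjoint; those of the first kind are close to points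
of the boundary walk that are at least `2 * q` steps apart. -/
theorem card_mul_le_of_separated (hΓ : Γ.Connected) {walk : List V} {F : Finset V} {q m n : ℕ}
    (hq : 0 < q) (hwalk : walk.IsChain fun a b => a = b ∨ Γ.Adj a b)
    (hn : walk.length ≤ n + 1) {Z : Finset V} (hZ : ∀ z ∈ Z, IsGood Γ walk F q m z)
    (hsep : ∀ z ∈ Z, ∀ z' ∈ Z, z ≠ z' → 6 * q < Γ.dist z z') :
    Z.card * (q * m) ≤ F.card + n * m + q * m := by
  set Z₁ := Z.filter fun z => ∃ w ∈ walk, Γ.dist z w ≤ 2 * q with hZ₁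
  set Z₂ := Z.filter fun z => ¬ ∃ w ∈ walk, Γ.dist z w ≤ 2 * q with hZ₂
  have hcard : Z.card = Z₁.card + Z₂.card := (Finset.card_filter_add_card_filter_not _).symm
  have hc₂ : Z₂.card * (q * m) ≤ F.card := by
    have h1 : ∀ z ∈ Z₂, q * m ≤ (F.filter fun v => Γ.dist z v ≤ 2 * q).card := by
      intro z hz
      rw [hZ₂, Finset.mem_filter] at hz
      exact (hZ z hz.1).resolve_left hz.2
    have h2 : (Z₂ : Set V).PairwiseDisjoint fun z => F.filter fun v => Γ.dist z v ≤ 2 * q := by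
      intro z hz z' hz' hne
      refine Finset.disjoint_left.2 fun v hv hv' => ?_
      have h3 := hsep z (Finset.mem_filter.1 hz).1 z' (Finset.mem_filter.1 hz').1 hne
      have h4 := (Finset.mem_filter.1 hv).2
      have h5 := (Finset.mem_filter.1 hv').2
      have h6 := hΓ.dist_triangle (u := z) (v := v) (w := z')
      rw [SimpleGraph.dist_comm (u := v)] at h6
      omega
    calc Z₂.card * (q * m) ≤ ∑ z ∈ Z₂, (F.filter fun v => Γ.dist z v ≤ 2 * q).card := by
          rw [← smul_eq_mul]
          exact Finset.card_nsmul_le_sum _ _ _ h1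
      _ = (Z₂.biUnion fun z => F.filter fun v => Γ.dist z v ≤ 2 * q).card :=
          (Finset.card_biUnion h2).symm
      _ ≤ F.card := Finset.card_le_card (Finset.biUnion_subset.2 fun z _ => Finset.filter_subset _ _)
  have hc₁ : Z₁.card ≤ n / (2 * q) + 1 := by
    have h1 : ∀ z ∈ Z₁, ∃ i, ∃ h : i < walk.length, Γ.dist z walk[i] ≤ 2 * q := by
      intro z hz
      obtain ⟨w, hw, h⟩ := (Finset.mem_filter.1 hz).2
      obtain ⟨i, hi, rfl⟩ := List.mem_iff_getElem.1 hw
      exact ⟨i, hi, h⟩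
    choose! I hI using h1
    have h2 : ∀ z ∈ Z₁, ∀ z' ∈ Z₁, I z ≤ I z' → I z' < I z + 2 * q → z = z' := by
      intro z hz z' hz' h h'
      by_contra hne
      obtain ⟨hi, h3⟩ := hI z hz
      obtain ⟨hi', h4⟩ := hI z' hz'
      have h5 := hsep z (Finset.mem_filter.1 hz).1 z' (Finset.mem_filter.1 hz').1 hne
      have h6 := dist_getElem_le hΓ hwalk (i := I z) (k := I z' - I z) (by omega)
      have h7 : walk[I z + (I z' - I z)]'(by omega) = walk[I z'] := by
        congr 1
        omega
      rw [h7] at h6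
      have h8 := hΓ.dist_triangle (u := z) (v := walk[I z]) (w := z')
      have h9 := hΓ.dist_triangle (u := walk[I z]) (v := walk[I z']) (w := z')
      rw [SimpleGraph.dist_comm (u := walk[I z'])] at h9
      omega
    have h3 : Set.InjOn (fun z => I z / (2 * q)) (Z₁ : Set V) := by
      intro z hz z' hz' h
      have e1 := Nat.div_add_mod (I z) (2 * q)
      have e2 := Nat.div_add_mod (I z') (2 * q)
      have e3 := Nat.mod_lt (I z) (show 2 * q > 0 by omega)
      have e4 := Nat.mod_lt (I z') (show 2 * q > 0 by omega)
      simp only at h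
      rw [h] at e1
      rcases le_total (I z) (I z') with hle | hle
      · exact h2 z hz z' hz' hle (by omega)
      · exact (h2 z' hz' z hz hle (by omega)).symm
    have h4 : ∀ z ∈ Z₁, I z / (2 * q) ∈ Finset.range (n / (2 * q) + 1) := by
      intro z hz
      obtain ⟨hi, -⟩ := hI z hz
      exact Finset.mem_range.2 (Nat.lt_succ_of_le (Nat.div_le_div_right (by omega)))
    simpa using Finset.card_le_card_of_injOn _ h4 h3
  have h5 : n / (2 * q) * (q * m) ≤ n * m := by
    have := Nat.div_mul_le_self n (2 * q)
    calc n / (2 * q) * (q * m) ≤ n / (2 * q) * (2 * q) * m := by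
          rw [mul_assoc]
          exact Nat.mul_le_mul_left _ (Nat.mul_le_mul_right _ (by omega))
      _ ≤ n * m := Nat.mul_le_mul_right _ this
  have h6 := Nat.mul_le_mul_right (q * m) hc₁
  rw [hcard, add_mul]
  rw [add_mul, one_mul] at h6
  omega

/-- A net of good vertices of controlled size, such that the hulls of balls around them cover the
graph and no hull contains another one. -/
theorem exists_net [Finite V] (hΓ : Γ.Connected) {faces : List (List V)}
    {walk : List V} {ρ m n : ℕ} (hρ : 0 < ρ * m)
    (hexact : ∀ c : V → V → ℤˣ, (∀ a b, c a b = c b a) → (∀ f ∈ faces, along c f = 1) →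
      ∃ g : V → ℤˣ, ∀ a b, Γ.Adj a b → c a b = g a * g b)
    (hclosed : ∀ f ∈ faces, f.head? = f.getLast?)
    (hchain : ∀ f ∈ faces, f.IsChain fun a b => a = b ∨ Γ.Adj a b)
    (hdist : ∀ f ∈ faces, ∀ a ∈ f, ∀ b ∈ f, Γ.dist a b ≤ ρ)
    (hwalk : walk.IsChain fun a b => a = b ∨ Γ.Adj a b) (hne : walk ≠ [])
    (hn : walk.length ≤ n + 1)
    {F : Finset V} (hF : ∀ f ∈ faces, ∀ v ∈ f, v ∈ F) :
    ∃ Z : Finset V, Z.card * (ρ * m * m) ≤ F.card + n * m + ρ * m * m ∧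
      (∀ v, ∃ z ∈ Z, v ∈ hull Γ {w | w ∈ walk} (ball Γ z (7 * (ρ * m)))) ∧
      ∀ z ∈ Z, ∀ z' ∈ Z, hull Γ {w | w ∈ walk} (ball Γ z' (7 * (ρ * m))) ⊆
        hull Γ {w | w ∈ walk} (ball Γ z (7 * (ρ * m))) → z' = z := by
  classical
  have := Fintype.ofFinite V
  set q := ρ * m with hq
  set H : V → Set V := fun z => hull Γ {w | w ∈ walk} (ball Γ z (7 * q)) with hH
  -- A maximal separated set of good vertices.
  obtain ⟨Z₀, -, hZ₀⟩ := (Set.toFinite {Z : Finset V | (∀ z ∈ Z, IsGood Γ walk F q m z) ∧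
    ∀ z ∈ Z, ∀ z' ∈ Z, z ≠ z' → 6 * q < Γ.dist z z'}).exists_le_maximal
      (a := ∅) ⟨by simp, by simp⟩
  have hcard := card_mul_le_of_separated hΓ hρ hwalk hn hZ₀.prop.1 hZ₀.prop.2
  have hnear : ∀ p, IsGood Γ walk F q m p → ∃ z ∈ Z₀, Γ.dist z p ≤ 6 * q := by
    intro p hp
    by_contra! hfar
    have hins : insert p Z₀ ≤ Z₀ := by
      refine hZ₀.le_of_ge ⟨fun z hz => ?_, fun z hz z' hz' hne => ?_⟩ (Finset.subset_insert _ _)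
      · rcases Finset.mem_insert.1 hz with rfl | hz
        · exact hp
        · exact hZ₀.prop.1 z hz
      · rcases Finset.mem_insert.1 hz with rfl | hz₁ <;>
          rcases Finset.mem_insert.1 hz' with rfl | hz₂
        · exact absurd rfl hne
        · rw [SimpleGraph.dist_comm]
          exact hfar z' hz₂
        · exact hfar z hz₁
        · exact hZ₀.prop.2 z hz₁ z' hz₂ hne
    have := hfar p (hins (Finset.mem_insert_self _ _))
    simp at this
  have hcover : ∀ v, ∃ z ∈ Z₀, v ∈ H z := by
    intro v
    obtain ⟨p, hp, hv⟩ :=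
      exists_isGood_mem_hull hΓ hρ hexact hclosed hchain hdist hwalk hne hF v
    obtain ⟨z, hz, hzp⟩ := hnear p hp
    -- The ball of radius `q` around `p` lies in that of radius `6 * q + q` around `z`.
    refine ⟨z, hz, hull_subset_hull ?_ hv⟩
    refine Set.Subset.trans (fun u hu => ?_) subset_hull
    simp only [ball, Set.mem_ofPred_eq] at hu ⊢
    have := hΓ.dist_triangle (u := z) (v := p) (w := u)
    omega
  -- A minimal subfamily whose hulls still cover.
  obtain ⟨Z, hZZ, hZ⟩ := (Set.toFinite {Z : Finset V | ∀ v, ∃ z ∈ Z, v ∈ H z}).exists_le_minimal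
    hcover
  refine ⟨Z, le_trans (Nat.mul_le_mul_right _ (Finset.card_le_card hZZ)) hcard, hZ.prop,
    fun z hz z' hz' hsub => ?_⟩
  by_contra hne
  have h1 : Z ≤ Z.erase z' := by
    refine hZ.le_of_le (fun v => ?_) (Finset.erase_subset _ _)
    obtain ⟨y, hy, hv⟩ := hZ.prop v
    by_cases hyz : y = z'
    · subst hyz
      exact ⟨z, Finset.mem_erase.2 ⟨fun h => hne h.symm, hz⟩, hsub hv⟩
    · exact ⟨y, Finset.mem_erase.2 ⟨hyz, hy⟩, hv⟩
  exact Finset.notMem_erase z' Z (h1 hz')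

end Cover

/-! ### Labellings with few colour classes -/

section Labelling

variable {V : Type*} {Γ : SimpleGraph V}

/-- Nearest-site maps whose cells are star-shaped: ties are broken by a fixed order. -/
theorem exists_nearest [Finite V] (hΓ : Γ.Connected) {Z : Finset V} (hZ : Z.Nonempty) :
    ∃ σ : V → V, (∀ v, σ v ∈ Z) ∧ (∀ v, ∀ z ∈ Z, Γ.dist (σ v) v ≤ Γ.dist z v) ∧
      ∀ v, v ≠ σ v → ∃ u, Γ.Adj v u ∧ Γ.dist (σ v) u + 1 = Γ.dist (σ v) v ∧ σ u = σ v := by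
  have := Fintype.ofFinite V
  set N := Fintype.card V with hN
  let idx : V → ℕ := fun v => Fintype.equivFin V v
  have hidx : ∀ v, idx v < N := fun v => (Fintype.equivFin V v).2
  let key : V → V → ℕ := fun z v => idx z + N * Γ.dist z v
  have hkey : ∀ z z' v, key z v = key z' v → z = z' := by
    intro z z' v h
    have h1 : key z v % N = key z' v % N := by rw [h]
    simp only [key, Nat.add_mul_mod_self_left, Nat.mod_eq_of_lt (hidx _)] at h1
    exact (Fintype.equivFin V).injective (Fin.ext h1)
  have hmin : ∀ v, ∃ z ∈ Z, ∀ z' ∈ Z, key z v ≤ key z' v := fun v =>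
    Finset.exists_min_image Z (fun z => key z v) hZ
  choose σ hσZ hσ using hmin
  refine ⟨σ, hσZ, fun v z hz => ?_, fun v hv => ?_⟩
  · by_contra! hlt
    have h1 := hσ v z hz
    have h2 := hidx z
    have h3 : N * (Γ.dist z v + 1) ≤ N * Γ.dist (σ v) v := Nat.mul_le_mul_left _ hlt
    simp only [key, mul_add, mul_one] at h1 h3
    omega
  · obtain ⟨u, huv, hu⟩ := exists_adj_dist_succ hΓ hv
    refine ⟨u, huv, hu, hkey _ _ v (le_antisymm ?_ (hσ v _ (hσZ u)))⟩
    have h1 := hσ u _ (hσZ v)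
    have h2 := dist_le_succ_of_adj hΓ (z := σ u) huv.symm
    have h3 := Nat.mul_le_mul_left N h2
    have h4 : N * Γ.dist (σ v) v = N * Γ.dist (σ v) u + N := by rw [← hu, mul_add, mul_one]
    simp only [key, mul_add, mul_one] at h1 h3 ⊢
    omega

/-- Suppose that the hulls of the balls of radius `R` around the points of `Z` cover, and none
contains another. Then the vertices can be labelled by points of `Z`, with connected colour
classes, so that labels of neighbours are close to each other and the vertices of `W` are close to
their labels. Vertices in no ball are labelled like a neighbour of their component; this works
since the balls touching such a component all meet the ball in whose hull the component lies. -/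
theorem exists_labelling [Finite V] (hΓ : Γ.Connected) {W : Set V} {R : ℕ} {Z : Finset V}
    (hcover : ∀ v, ∃ z ∈ Z, v ∈ hull Γ W (ball Γ z R))
    (hanti : ∀ z ∈ Z, ∀ z' ∈ Z, hull Γ W (ball Γ z' R) ⊆ hull Γ W (ball Γ z R) → z' = z) :
    ∃ l : V → V, (∀ h : V → ℚ, (∀ a b, Γ.Adj a b → l a = l b → h a = h b) →
        (∀ z ∈ Z, h z = 0) → h = 0) ∧
      (∀ a b, Γ.Adj a b → l a ≠ l b → Γ.dist (l a) (l b) ≤ 4 * R + 1) ∧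
      ∀ w ∈ W, Γ.dist (l w) w ≤ R := by
  classical
  obtain ⟨v₀⟩ := hΓ.nonempty
  obtain ⟨z₀, hz₀, -⟩ := hcover v₀
  obtain ⟨σ, hσZ, hσmin, hσ⟩ := exists_nearest hΓ ⟨z₀, hz₀⟩
  let U : Set V := {v | ∃ z ∈ Z, Γ.dist z v ≤ R}
  have hU : ∀ v, v ∈ U → Γ.dist (σ v) v ≤ R := fun v ⟨z, hz, h⟩ => (hσmin v z hz).trans h
  have hU' : ∀ v, Γ.dist (σ v) v ≤ R → v ∈ U := fun v h => ⟨σ v, hσZ v, h⟩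
  let step : V → V → Prop := fun a b => Γ.Adj a b ∧ a ∉ U ∧ b ∉ U
  have hsymm : Std.Symm step := ⟨fun a b h => ⟨h.1.symm, h.2.2, h.2.1⟩⟩
  let reach : V → Set V := fun v => {u | Relation.ReflTransGen step v u}
  let pick : Set V → V := fun S =>
    if h : ∃ y, y ∈ U ∧ ∃ u ∈ S, Γ.Adj u y then h.choose else v₀
  have hreach : ∀ a b, Relation.ReflTransGen step a b → reach a = reach b := by
    intro a b hab
    ext u
    exact ⟨fun h => ((Relation.ReflTransGen.stdSymm (r := step)).symm _ _ hab).trans h,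
      fun h => hab.trans h⟩
  have hpick : ∀ v, v ∉ U → pick (reach v) ∈ U ∧ ∃ u ∈ reach v, Γ.Adj u (pick (reach v)) := by
    intro v hv
    have h : ∃ y, y ∈ U ∧ ∃ u ∈ reach v, Γ.Adj u y := by
      obtain ⟨r⟩ := hΓ.preconnected v z₀
      have hz₀r : z₀ ∉ reach v := by
        intro h
        rcases h.cases_tail with h | ⟨c, -, hc⟩
        · exact hv (h ▸ ⟨z₀, hz₀, by simp⟩)
        · exact hc.2.2 ⟨z₀, hz₀, by simp⟩
      obtain ⟨d, -, hd1, hd2⟩ := r.exists_boundary_dart (reach v) Relation.ReflTransGen.refl hz₀r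
      refine ⟨d.snd, ?_, d.fst, hd1, d.adj⟩
      by_contra hn
      refine hd2 (Relation.ReflTransGen.tail hd1 ⟨d.adj, ?_, hn⟩)
      rcases Relation.ReflTransGen.cases_tail hd1 with h | ⟨c, -, hc⟩
      · rwa [h]
      · exact hc.2.2
    simp only [pick, dif_pos h]
    exact h.choose_spec
  let l : V → V := fun v => if v ∈ U then σ v else σ (pick (reach v))
  have hlU : ∀ v, v ∈ U → l v = σ v := fun v hv => if_pos hv
  have hlU' : ∀ v, v ∉ U → l v = σ (pick (reach v)) := fun v hv => if_neg hv
  have hreachU : ∀ v u, v ∉ U → u ∈ reach v → u ∉ U := by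
    intro v u hv hu
    rcases Relation.ReflTransGen.cases_tail hu with h | ⟨c, -, hc⟩
    · rwa [h]
    · exact hc.2.2
  -- All balls touching a component of the complement of `U` are close to each other.
  have hclose : ∀ b, b ∉ U → ∀ z ∈ Z, b ∈ hull Γ W (ball Γ z R) → ∀ y ∈ U, ∀ u ∈ reach b,
      Γ.Adj u y → Γ.dist z (σ y) ≤ 2 * R := by
    intro b hb z hz hbz y hy u hu huy
    by_contra! hfar
    have hdisj : ∀ v, Γ.dist (σ y) v ≤ R → v ∉ ball Γ z R := by
      intro v hv hv'
      have h1 := hΓ.dist_triangle (u := z) (v := v) (w := σ y)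
      rw [SimpleGraph.dist_comm (u := v)] at h1
      simp only [ball, Set.mem_ofPred_eq] at hv'
      omega
    have hnot : ∀ v, v ∉ U → v ∉ ball Γ z R := fun v hv hv' => hv ⟨z, hz, hv'⟩
    have hiff : ∀ n v, Γ.dist (σ y) v = n → n ≤ R →
        (v ∈ outside Γ W (ball Γ z R) ↔ σ y ∈ outside Γ W (ball Γ z R)) := by
      intro n
      induction n with
      | zero =>
        intro v hv _
        rw [hΓ.dist_eq_zero_iff.1 hv]
      | succ n ih =>
        intro v hv hn
        obtain ⟨u', huv, hu'⟩ := exists_adj_dist_succ hΓ (z := σ y) (v := v) (by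
          rintro rfl
          simp at hv)
        rw [← ih u' (by omega) (by omega)]
        have h1 := hdisj v (by omega)
        have h2 := hdisj u' (by omega)
        exact ⟨fun h => mem_outside_of_adj h huv.symm h2 h1,
          fun h => mem_outside_of_adj h huv h1 h2⟩
    have hys : y ∉ outside Γ W (ball Γ z R) := by
      intro hyo
      have huo : u ∈ outside Γ W (ball Γ z R) :=
        mem_outside_of_adj hyo huy (hnot u (hreachU b u hb hu)) (hdisj y (hU y hy))
      refine hbz ?_
      change Relation.ReflTransGen step b u at hu
      clear hbz hb
      induction hu using Relation.ReflTransGen.head_induction_on with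
      | refl => exact huo
      | head h _ ih => exact mem_outside_of_adj ih h.1 (hnot _ h.2.1) (hnot _ h.2.2)
    have hsub : ball Γ (σ y) R ⊆ hull Γ W (ball Γ z R) := fun v hv hvo =>
      hys ((hiff _ y rfl (hU y hy)).2 ((hiff _ v rfl hv).1 hvo))
    have := hanti z hz (σ y) (hσZ y) (hull_subset_hull hsub)
    rw [this] at hfar
    simp at hfar
  have hmixed : ∀ a b, Γ.Adj a b → a ∈ U → b ∉ U → Γ.dist (l a) (l b) ≤ 4 * R + 1 := by
    intro a b hab ha hb
    obtain ⟨z, hz, hbz⟩ := hcover b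
    obtain ⟨hy, u, hu, huy⟩ := hpick b hb
    have h1 := hclose b hb z hz hbz a ha b .refl hab.symm
    have h2 := hclose b hb z hz hbz _ hy u hu huy
    rw [hlU a ha, hlU' b hb]
    have h3 := hΓ.dist_triangle (u := σ a) (v := z) (w := σ (pick (reach b)))
    rw [SimpleGraph.dist_comm (u := σ a) (v := z)] at h3
    omega
  refine ⟨l, fun h hh hZ => ?_, fun a b hab hne => ?_, fun w hw => ?_⟩
  · have hhU : ∀ n v, Γ.dist (σ v) v = n → n ≤ R → h v = 0 := by
      intro n
      induction n with
      | zero =>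
        intro v hv _
        rw [← hΓ.dist_eq_zero_iff.1 hv]
        exact hZ _ (hσZ v)
      | succ n ih =>
        intro v hv hn
        obtain ⟨u, huv, hu, hs⟩ := hσ v (by
          intro h
          rw [← h] at hv
          simp at hv)
        rw [hh v u huv ?_]
        · exact ih u (by rw [hs]; omega) (by omega)
        · rw [hlU v (hU' v (by omega)), hlU u (hU' u (by rw [hs]; omega)), hs]
    ext v
    by_cases hv : v ∈ U
    · exact hhU _ v rfl (hU v hv)
    · obtain ⟨hy, u, hu, huy⟩ := hpick v hv
      have h1 : h u = 0 := by
        rw [hh u _ huy ?_]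
        · exact hhU _ _ rfl (hU _ hy)
        · rw [hlU' u (hreachU v u hv hu), hlU _ hy, hreach v u hu]
      change Relation.ReflTransGen step v u at hu
      have h2 : h v = h u := by
        clear hy huy hv
        induction hu using Relation.ReflTransGen.head_induction_on with
        | refl => rfl
        | @head a c hac _ ih =>
          rw [← ih]
          refine hh a c hac.1 ?_
          rw [hlU' a hac.2.1, hlU' c hac.2.2, hreach a c (.single hac)]
      rw [h2, h1]
      rfl
  · by_cases ha : a ∈ U <;> by_cases hb : b ∈ U
    · have h1 := hU a ha
      have h2 := hU b hb
      rw [hlU a ha, hlU b hb]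
      have h3 := hΓ.dist_triangle (u := σ a) (v := a) (w := σ b)
      have h4 := hΓ.dist_triangle (u := a) (v := b) (w := σ b)
      rw [SimpleGraph.dist_eq_one_iff_adj.2 hab, SimpleGraph.dist_comm (u := b)] at h4
      omega
    · exact hmixed a b hab ha hb
    · rw [SimpleGraph.dist_comm]
      exact hmixed b a hab.symm hb ha
    · refine absurd ?_ hne
      rw [hlU' a ha, hlU' b hb, hreach a b (.single ⟨hab, ha, hb⟩)]
  · obtain ⟨z, hz, hwz⟩ := hcover w
    have hwU : w ∈ U := by
      refine ⟨z, hz, ?_⟩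
      by_contra hn
      exact hwz (mem_outside_of_mem hw hn)
    rw [hlU w hwU]
    exact hU w hwU

end Labelling

/-! ### Coarse fillings from diagrams -/

section Filling

variable {α G : Type*} [Group G]

theorem mem_shortRelations_of_norm_le [DecidableEq α] {y : α → G} {k : ℕ} {g : FreeGroup α}
    (h : g.norm ≤ k) (hg : FreeGroup.lift y g = 1) : g ∈ shortRelations y k :=
  ⟨g.toWord, h, FreeGroup.mk_toWord, hg⟩

theorem norm_le_of_mem_shortRelations [DecidableEq α] {y : α → G} {k : ℕ} {g : FreeGroup α}
    (h : g ∈ shortRelations y k) : g.norm ≤ k := by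
  obtain ⟨w, hw, rfl, -⟩ := h
  exact FreeGroup.norm_mk_le.trans hw

section Along

variable {V : Type*}

theorem map_along {M N : Type*} [Monoid M] [Monoid N] (f : M →* N) (φ : V → V → M) (l : List V) :
    f (along φ l) = along (fun a b => f (φ a b)) l := by
  induction l with
  | nil => exact map_one f
  | cons a l ih =>
    cases l with
    | nil => exact map_one f
    | cons b l =>
      simp only [along, map_mul] at ih ⊢
      rw [ih]

theorem norm_along_le [DecidableEq α] {r : V → V → Prop} {φ : V → V → FreeGroup α} {B : ℕ}
    (h : ∀ a b, r a b → (φ a b).norm ≤ B) {l : List V} (hl : l.IsChain r) :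
    (along φ l).norm ≤ (l.length - 1) * B := by
  induction l with
  | nil => simp [along]
  | cons a l ih =>
    cases l with
    | nil => simp [along]
    | cons b l =>
      rw [List.isChain_cons_cons] at hl
      have h1 := ih hl.2
      have h2 := h a b hl.1
      have h3 := FreeGroup.norm_mul_le (φ a b) (along φ (b :: l))
      simp only [along, List.length_cons, Nat.add_sub_cancel, add_mul, one_mul] at h1 ⊢
      omega

theorem changes_comp {L L' : Type*} {i : L → L'} (hi : Function.Injective i) (l : V → L)
    (f : List V) : changes (i ∘ l) f = changes l f := by
  induction f with
  | nil => rfl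
  | cons a f ih =>
    cases f with
    | nil => rfl
    | cons b f =>
      rw [changes, changes, ih]
      by_cases h : l a = l b
      · simp [h]
      · simp [h, hi.ne h]

/-- A closed list with at most two changes of colour goes back and forth between two colours. -/
theorem along_eq_one_of_changes_le {M L : Type*} [Monoid M] {β : L → L → M} {l : V → L}
    (h1 : ∀ z, β z z = 1) (h2 : ∀ z z', β z z' * β z' z = 1) {f : List V}
    (hf : f.head? = f.getLast?) (hc : changes l f ≤ 2) :
    along (fun a b => β (l a) (l b)) f = 1 := by
  have key : ∀ x u y,
      (changes l (x :: u ++ [y]) = 0 → along (fun a b => β (l a) (l b)) (x :: u ++ [y]) = 1) ∧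
      (changes l (x :: u ++ [y]) = 1 →
        along (fun a b => β (l a) (l b)) (x :: u ++ [y]) = β (l x) (l y)) ∧
      (changes l (x :: u ++ [y]) = 2 →
        ∃ c, along (fun a b => β (l a) (l b)) (x :: u ++ [y]) = β (l x) c * β c (l y)) := by
    intro x u y
    induction u generalizing x with
    | nil =>
      by_cases h : l x = l y <;> simp [changes, along, h, h1]
    | cons z u ih =>
      obtain ⟨i0, i1, i2⟩ := ih z
      simp only [List.cons_append, changes, along] at i0 i1 i2 ⊢
      by_cases h : l x = l z
      · rw [if_pos h, zero_add, h, h1, one_mul]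
        exact ⟨i0, i1, i2⟩
      · rw [if_neg h]
        refine ⟨fun h' => by omega, fun h' => ?_, fun h' => ⟨l z, ?_⟩⟩
        · rw [i0 (by omega), mul_one,
            label_eq_of_changes_eq_zero (ℓ := l) z u y (by rw [List.cons_append]; omega)]
        · rw [i1 (by omega)]
  rcases f with _ | ⟨x, f⟩
  · rfl
  · rcases List.eq_nil_or_concat' f with rfl | ⟨u, y, rfl⟩
    · rfl
    · have hxy : x = y := by simpa [List.getLast?_cons] using hf
      subst hxy
      obtain ⟨i0, i1, i2⟩ := key x u x
      rw [List.cons_append] at i0 i1 i2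
      obtain h | h | h : changes l (x :: (u ++ [x])) = 0 ∨ changes l (x :: (u ++ [x])) = 1 ∨
        changes l (x :: (u ++ [x])) = 2 := by omega
      · exact i0 h
      · rw [i1 h, h1]
      · obtain ⟨c, hc⟩ := i2 h
        rw [hc, h2]

end Along

/-- Comparison of a word with the product of the elements `φ a b` along its vertices, when every
vertex `v` is joined to its label `l v` by a word `τ v` of length at most `R`, and `φ a b` joins the
labels of `a` and `b`. The word is cut where the label changes, and into pieces of length at most
`m`; `acc` is the part of the current piece which has been read. -/
theorem exists_boundary_pieces [DecidableEq α] {V : Type*} {y : α → G} {adj : V → V → Prop}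
    {pos : V → G} {l : V → V} {τ : V → FreeGroup α} {φ : V → V → FreeGroup α} {R B m K : ℕ}
    (hm : 0 < m) (hK : 2 * R + m + 1 + B ≤ K)
    (hτ : ∀ v, FreeGroup.lift y (τ v) = (pos v)⁻¹ * pos (l v))
    (hφ : ∀ a b, FreeGroup.lift y (φ a b) = (pos (l a))⁻¹ * pos (l b))
    (hφ1 : ∀ a b, l a = l b → φ a b = 1) (hφB : ∀ a b, adj a b → (φ a b).norm ≤ B)
    {w : List (α × Bool)} {x : V} {u : List V} (hs : Spells y adj pos w (x :: u))
    (hR : ∀ v ∈ x :: u, (τ v).norm ≤ R) {x₀ : V} {acc : FreeGroup α} {j : ℕ}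
    (hR₀ : (τ x₀).norm ≤ R) (hj : j ≤ m) (hacc : acc.norm ≤ j)
    (hpos : FreeGroup.lift y acc = (pos x₀)⁻¹ * pos x) (hl : l x₀ = l x) :
    ∃ k X, IsConjProductLE (shortRelations y K) k X ∧
      k * m ≤ 2 * m * changes l (x :: u) + (j + w.length) + m ∧
      acc * FreeGroup.mk w = τ x₀ * (X * along φ (x :: u)) *
        (τ ((x :: u).getLast (by simp)))⁻¹ := by
  have hflush : ∀ {x₀ x : V} {acc : FreeGroup α}, (τ x₀).norm ≤ R → (τ x).norm ≤ R →
      acc.norm ≤ m → FreeGroup.lift y acc = (pos x₀)⁻¹ * pos x → l x₀ = l x →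
      IsConjProductLE (shortRelations y K) 1 ((τ x₀)⁻¹ * acc * τ x) := by
    intro x₀ x acc h0 h1 h2 h3 h4
    refine .of_mem (mem_shortRelations_of_norm_le ?_ ?_)
    · have e1 := FreeGroup.norm_mul_le ((τ x₀)⁻¹ * acc) (τ x)
      have e2 := FreeGroup.norm_mul_le (τ x₀)⁻¹ acc
      rw [FreeGroup.norm_inv_eq] at e2
      omega
    · simp only [map_mul, map_inv, hτ, h3, h4]
      group
  induction w generalizing x u x₀ acc j with
  | nil =>
    obtain ⟨v, hv⟩ := hs
    obtain ⟨rfl, rfl⟩ := List.cons.inj hv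
    refine ⟨1, _, hflush hR₀ (hR x (by simp)) (hacc.trans hj) hpos hl, by simp, ?_⟩
    simp only [along, List.getLast_singleton, ← FreeGroup.one_eq_mk]
    group
  | cons a w ih =>
    obtain ⟨x', u, rfl⟩ : ∃ x' u', u = x' :: u' := by
      cases u with
      | nil => exact absurd hs (by simp [Spells])
      | cons x' u => exact ⟨x', u, rfl⟩
    obtain ⟨hadj, hpx, hs⟩ := hs
    have hmk : FreeGroup.mk (a :: w) = FreeGroup.mk [a] * FreeGroup.mk w := by
      rw [FreeGroup.mul_mk]
      rfl
    have ha : (FreeGroup.mk [a]).norm ≤ 1 := FreeGroup.norm_mk_le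
    have hav : FreeGroup.lift y (FreeGroup.mk [a]) = (pos x)⁻¹ * pos x' := by
      rw [hpx, inv_mul_cancel_left, lift_mk_cons]
      simp [← FreeGroup.one_eq_mk]
    have hR' : ∀ v ∈ x' :: u, (τ v).norm ≤ R := fun v hv => hR v (List.mem_cons_of_mem _ hv)
    have hRx : (τ x).norm ≤ R := hR x (by simp)
    have hRx' : (τ x').norm ≤ R := hR x' (by simp)
    have hlast : (x :: x' :: u).getLast (by simp) = (x' :: u).getLast (by simp) := by simp
    by_cases hxx : l x = l x'
    · have hch : changes l (x :: x' :: u) = changes l (x' :: u) := by simp [changes, hxx]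
      have hal : along φ (x :: x' :: u) = along φ (x' :: u) := by simp [along, hφ1 x x' hxx]
      rw [hch, hal, hlast]
      rcases hj.lt_or_eq with hjm | rfl
      · obtain ⟨k, X, h1, h2, h3⟩ := ih hs hR' (acc := acc * FreeGroup.mk [a]) (j := j + 1) hR₀
          (by omega) ((FreeGroup.norm_mul_le _ _).trans (by omega))
          (by rw [map_mul, hpos, hav]; group) (hl.trans hxx)
        refine ⟨k, X, h1, by rw [List.length_cons]; omega, ?_⟩
        rw [hmk, ← mul_assoc, h3]
      · obtain ⟨k, X, h1, h2, h3⟩ := ih hs hR' (acc := FreeGroup.mk [a]) (j := 1) hRx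
          (by omega) ha hav hxx
        refine ⟨1 + k, _, (hflush hR₀ hRx hacc hpos hl).mul h1,
          by rw [List.length_cons, add_mul, one_mul]; omega, ?_⟩
        rw [hmk, h3]
        group
    · have hch : changes l (x :: x' :: u) = 1 + changes l (x' :: u) := by simp [changes, hxx]
      have hal : along φ (x :: x' :: u) = φ x x' * along φ (x' :: u) := rfl
      rw [hch, hal, hlast]
      obtain ⟨k, X, h1, h2, h3⟩ := ih hs hR' (acc := 1) (j := 0) hRx'
        (by omega) (by simp) (by simp) rfl
      have hpiece : IsConjProductLE (shortRelations y K) 1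
          ((τ x₀)⁻¹ * acc * FreeGroup.mk [a] * τ x' * (φ x x')⁻¹) := by
        refine .of_mem (mem_shortRelations_of_norm_le ?_ ?_)
        · have e1 := FreeGroup.norm_mul_le ((τ x₀)⁻¹ * acc * FreeGroup.mk [a] * τ x') (φ x x')⁻¹
          have e2 := FreeGroup.norm_mul_le ((τ x₀)⁻¹ * acc * FreeGroup.mk [a]) (τ x')
          have e3 := FreeGroup.norm_mul_le ((τ x₀)⁻¹ * acc) (FreeGroup.mk [a])
          have e4 := FreeGroup.norm_mul_le (τ x₀)⁻¹ acc
          have e5 := hφB x x' hadj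
          rw [FreeGroup.norm_inv_eq] at e1 e4
          omega
        · simp only [map_mul, map_inv, hτ, hpos, hav, hφ, hl]
          group
      refine ⟨1 + k, _, hpiece.mul (h1.conj (φ x x')), ?_, ?_⟩
      · rw [List.length_cons, add_mul, mul_add]
        omega
      · rw [one_mul] at h3
        rw [hmk, h3]
        group

/-- A word bounding a diagram with `A` cells is a product of about `A / m ^ 2 + n / m + 1`
conjugates of relations of length `O(m)`. The vertices of the diagram are labelled by the points of
a net at scale `m`. Cells with at most two labels disappear, and by Euler's formula the number of
the others is bounded by the size of the net. -/
theorem Diagram.exists_coarse_filling {y : α → G} {ρ A m : ℕ} {w : List (α × Bool)}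
    (D : Diagram y ρ w A) (hρ : 0 < ρ) (hm : 0 < m) :
    ∃ l, l * (m * m) ≤ 8 * A + 5 * (w.length * m) + 5 * (m * m) ∧
      IsConjProductLE (shortRelations y (45 * (ρ * ρ * m))) l (FreeGroup.mk w) := by
  classical
  have := D.finite
  have hρm : 0 < ρ * m := Nat.mul_pos hρ hm
  have hnil : D.walk ≠ [] := D.spells.ne_nil
  let Γ : SimpleGraph D.V := SimpleGraph.fromRel D.adj
  have hadj : ∀ a b, Γ.Adj a b → D.adj a b := fun a b h => h.2.elim id (D.symm _ _)
  have hadj' : ∀ a b, D.adj a b → a = b ∨ Γ.Adj a b := fun a b h =>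
    (eq_or_ne a b).imp_right fun hne => ⟨hne, Or.inl h⟩
  have hΓ : Γ.Connected := by
    obtain ⟨v, -⟩ := List.exists_mem_of_ne_nil _ hnil
    refine (SimpleGraph.connected_iff _).2 ⟨fun a b => ?_, ⟨v⟩⟩
    have := D.conn a b
    induction this with
    | refl => rfl
    | tail _ h ih =>
      rcases hadj' _ _ h with rfl | h
      · exact ih
      · exact ih.trans h.reachable
  have hchain : ∀ f ∈ D.faces, f.IsChain fun a b => a = b ∨ Γ.Adj a b := fun f hf =>
    (D.face_chain f hf).imp hadj'
  have hdist : ∀ f ∈ D.faces, ∀ a ∈ f, ∀ b ∈ f, Γ.dist a b ≤ ρ := by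
    intro f hf
    have hlen := D.face_length f hf
    have key : ∀ i k (h : i + k < f.length), Γ.dist (f[i]'(by omega)) f[i + k] ≤ ρ := fun i k h =>
      (dist_getElem_le hΓ (hchain f hf) h).trans (by omega)
    intro a ha b hb
    obtain ⟨i, hi, rfl⟩ := List.mem_iff_getElem.1 ha
    obtain ⟨j, hj, rfl⟩ := List.mem_iff_getElem.1 hb
    rcases le_total i j with h | h
    · obtain ⟨k, rfl⟩ := Nat.exists_eq_add_of_le h
      exact key i k hj
    · obtain ⟨k, rfl⟩ := Nat.exists_eq_add_of_le h
      rw [SimpleGraph.dist_comm]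
      exact key j k hi
  have hF : D.faces.flatten.toFinset.card ≤ A * (ρ + 1) := by
    refine (List.toFinset_card_le _).trans ?_
    rw [List.length_flatten]
    refine (List.sum_le_card_nsmul _ (ρ + 1) fun x hx => ?_).trans ?_
    · obtain ⟨f, hf, rfl⟩ := List.mem_map.1 hx
      exact D.face_length f hf
    · rw [List.length_map, smul_eq_mul]
      exact Nat.mul_le_mul_right _ D.faces_length
  have hwalk := D.spells.isChain.imp hadj'
  obtain ⟨Z, hZcard, hcover, hanti⟩ := exists_net (F := D.faces.flatten.toFinset) hΓ hρm
    (fun c h1 h2 => (D.exact c h1 h2).imp fun g hg a b hab => hg a b (hadj a b hab))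
    D.face_closed hchain hdist hwalk hnil D.spells.length.le
    (fun f hf v hv => by simpa using ⟨f, hf, hv⟩)
  have hZ : Z.card * (m * m) ≤ 2 * A + w.length * m + m * m := by
    refine Nat.le_of_mul_le_mul_left ?_ hρ
    nlinarith [Nat.mul_le_mul_left A hρ, Nat.mul_le_mul_left (w.length * m) hρ]
  obtain ⟨l, hlZ, hlD, hlW⟩ := exists_labelling hΓ hcover hanti
  -- Euler's formula bounds the numbers of colour changes by the size of the net.
  have := Fintype.ofFinite D.V
  let idx : D.V → ℕ := fun v => Fintype.equivFin D.V v
  have hidx : Function.Injective idx := fun a b h =>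
    (Fintype.equivFin D.V).injective (Fin.ext h)
  have hE := D.euler (idx ∘ l)
  have hrank : Module.finrank ℚ (monoSpace D.adj (idx ∘ l)) ≤ Z.card := by
    let T : monoSpace D.adj (idx ∘ l) →ₗ[ℚ] (Z → ℚ) :=
      { toFun := fun h z => h.1 z
        map_add' := fun h k => rfl
        map_smul' := fun c k => rfl }
    have hT : Function.Injective T := by
      rw [← LinearMap.ker_eq_bot, LinearMap.ker_eq_bot']
      intro h hh
      refine Subtype.ext (hlZ h.1 (fun a b hab hl => ?_) fun z hz => congrFun hh ⟨z, hz⟩)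
      exact h.2 a b (hadj a b hab) (congrArg idx hl)
    simpa using LinearMap.finrank_le_finrank_of_injective hT
  simp only [changes_comp hidx] at hE
  -- Words joining vertices.
  have hword : ∀ a b, ∃ g : FreeGroup α, g.norm ≤ Γ.dist a b ∧
      FreeGroup.lift y g = (D.pos a)⁻¹ * D.pos b := by
    have key : ∀ {a b} (p : Γ.Walk a b), ∃ g : FreeGroup α, g.norm ≤ p.length ∧
        FreeGroup.lift y g = (D.pos a)⁻¹ * D.pos b := by
      intro a b p
      induction p with
      | nil => exact ⟨1, by simp, by simp⟩
      | @cons a c b hac p ih =>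
        obtain ⟨g, hg, hg'⟩ := ih
        obtain ⟨s, hs⟩ := D.adj_pos _ _ (hadj _ _ hac)
        refine ⟨FreeGroup.mk [s] * g, ?_, ?_⟩
        · have h1 := FreeGroup.norm_mul_le (FreeGroup.mk [s]) g
          have h2 : (FreeGroup.mk [s]).norm ≤ 1 := FreeGroup.norm_mk_le
          rw [SimpleGraph.Walk.length_cons]
          omega
        · rw [map_mul, hg', hs, lift_mk_cons, ← FreeGroup.one_eq_mk, map_one, mul_one]
          group
    intro a b
    obtain ⟨p, hp⟩ := hΓ.exists_walk_length_eq_dist a b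
    rw [← hp]
    exact key p
  choose g hgnorm hgpos using hword
  -- The words are made antisymmetric, as the field `fill` requires.
  let β : D.V → D.V → FreeGroup α := fun z z' =>
    if idx z < idx z' then g z z' else if idx z' < idx z then (g z' z)⁻¹ else 1
  have hβ1 : ∀ z, β z z = 1 := fun z => by simp [β]
  have hβ2 : ∀ z z', β z z' * β z' z = 1 := by
    intro z z'
    rcases lt_trichotomy (idx z) (idx z') with h | h | h
    · simp [β, h, h.not_gt]
    · simp [β, h]
    · simp [β, h, h.not_gt]
  have hβpos : ∀ z z', FreeGroup.lift y (β z z') = (D.pos z)⁻¹ * D.pos z' := by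
    intro z z'
    rcases lt_trichotomy (idx z) (idx z') with h | h | h
    · simp only [β, if_pos h, hgpos]
    · simp [hidx h, hβ1]
    · simp only [β, if_pos h, if_neg h.not_gt, map_inv, hgpos]
      group
  have hβnorm : ∀ z z', (β z z').norm ≤ Γ.dist z z' := by
    intro z z'
    rcases lt_trichotomy (idx z) (idx z') with h | h | h
    · simp only [β, if_pos h, hgnorm]
    · simp [hidx h, hβ1]
    · simp only [β, if_pos h, if_neg h.not_gt, FreeGroup.norm_inv_eq]
      rw [SimpleGraph.dist_comm]
      exact hgnorm _ _
  let φ : D.V → D.V → FreeGroup α := fun a b => β (l a) (l b)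
  have hφB : ∀ a b, D.adj a b → (φ a b).norm ≤ 4 * (7 * (ρ * m)) + 1 := by
    intro a b hab
    by_cases hl : l a = l b
    · simp [φ, hl, hβ1]
    · refine (hβnorm _ _).trans (hlD a b ((hadj' a b hab).resolve_left ?_) hl)
      rintro rfl
      exact hl rfl
  have hfaces : {e | ∃ f ∈ D.faces, along φ f = e} ⊆ shortRelations y (45 * (ρ * ρ * m)) := by
    rintro _ ⟨f, hf, rfl⟩
    refine mem_shortRelations_of_norm_le ?_ ?_
    · refine (norm_along_le hφB (D.face_chain f hf)).trans ?_
      have h1 : f.length - 1 ≤ ρ := by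
        have := D.face_length f hf
        omega
      refine (Nat.mul_le_mul_right _ h1).trans ?_
      nlinarith [Nat.mul_le_mul_left ρ hρm]
    · rw [map_along]
      simp only [φ, hβpos]
      exact along_inv_mul_of_closed (fun a => D.pos (l a)) (D.face_closed f hf)
  have hcount : (D.faces.countP fun f => along φ f ≠ 1) ≤
      (D.faces.map fun f => changes l f - 2).sum := by
    have key : ∀ fs : List (List D.V), (∀ f ∈ fs, f.head? = f.getLast?) →
        (fs.countP fun f => along φ f ≠ 1) ≤ (fs.map fun f => changes l f - 2).sum := by
      intro fs
      induction fs with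
      | nil => simp
      | cons f fs ih =>
        intro hfs
        have h1 := ih fun f hf => hfs f (List.mem_cons_of_mem _ hf)
        rw [List.countP_cons, List.map_cons, List.sum_cons]
        have h2 : (if decide (along φ f ≠ 1) = true then 1 else 0) ≤ changes l f - 2 := by
          split_ifs with h
          · by_contra hlt
            exact (of_decide_eq_true h)
              (along_eq_one_of_changes_le hβ1 hβ2 (hfs f (by simp)) (by omega))
          · exact Nat.zero_le _
        omega
    exact key _ D.face_closed
  have hfill := (D.fill φ fun a b => hβ2 _ _).mono hfaces hcount
  -- The boundary walk is close to the product of `φ` along it. The longest relations needed are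
  -- its pieces, of length `2 * (7 * (ρ * m)) + m + 1 + (4 * (7 * (ρ * m)) + 1) ≤ 45 * (ρ * ρ * m)`.
  obtain ⟨o, u, hou⟩ := List.exists_cons_of_ne_nil hnil
  have hlast : (o :: u).getLast (by simp) = o := by
    have h1 := D.closed
    rw [hou, List.getLast?_eq_some_getLast (by simp)] at h1
    exact (Option.some.inj h1).symm
  have hτR : ∀ v ∈ o :: u, (g v (l v)).norm ≤ 7 * (ρ * m) := fun v hv => by
    refine (hgnorm _ _).trans ?_
    rw [SimpleGraph.dist_comm]
    exact hlW v (by rwa [Set.mem_ofPred_eq, hou])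
  obtain ⟨k, X, hX, hk, hw⟩ := exists_boundary_pieces (K := 45 * (ρ * ρ * m))
    (B := 4 * (7 * (ρ * m)) + 1) (τ := fun v => g v (l v)) (φ := φ) (l := l) (x₀ := o) (acc := 1)
    (j := 0) hm (by nlinarith [Nat.mul_le_mul_left (ρ * m) hρ, Nat.mul_le_mul_right m hρ])
    (fun v => hgpos _ _) (fun a b => hβpos _ _) (fun a b h => by simp only [φ, h, hβ1]) hφB
    (hou ▸ D.spells) hτR (hτR o (by simp)) (Nat.zero_le _) (by simp) (by simp) rfl
  rw [hlast, one_mul] at hw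
  refine ⟨k + (D.faces.map fun f => changes l f - 2).sum, ?_, ?_⟩
  · rw [hou] at hE
    set S := (D.faces.map fun f => changes l f - 2).sum
    set c := changes l (o :: u)
    have h1 : c + S ≤ 2 * Z.card := by omega
    have h2 := Nat.mul_le_mul_right m hk
    have h3 := Nat.mul_le_mul_right (2 * (m * m)) h1
    nlinarith
  · rw [hw]
    refine (hX.mul ?_).conj _
    rw [← hou]
    exact hfill

end Filling

/-! ### Change of generating sets -/

section Transport

variable {α ι G : Type*} [Group G]

theorem shortRelations_mono (x : ι → G) {k m : ℕ} (h : k ≤ m) :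
    shortRelations x k ⊆ shortRelations x m := by
  rintro g ⟨w, hw, hg⟩
  exact ⟨w, hw.trans h, hg⟩

theorem lift_eq_one_of_mem_normalClosure {x : ι → G} {S : Set (FreeGroup ι)}
    (hS : ∀ s ∈ S, FreeGroup.lift x s = 1) {g : FreeGroup ι}
    (hg : g ∈ Subgroup.normalClosure S) : FreeGroup.lift x g = 1 := by
  have h : Subgroup.normalClosure S ≤ (FreeGroup.lift x).ker :=
    Subgroup.normalClosure_le_normal fun s hs => hS s hs
  exact h hg

theorem norm_lift_le [DecidableEq α] [DecidableEq ι] {u : ι → FreeGroup α} {L : ℕ}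
    (h : ∀ i, (u i).norm ≤ L) (g : FreeGroup ι) : (FreeGroup.lift u g).norm ≤ L * g.norm := by
  have key : ∀ w : List (ι × Bool), (FreeGroup.lift u (FreeGroup.mk w)).norm ≤ L * w.length := by
    intro w
    induction w with
    | nil => simp [← FreeGroup.one_eq_mk]
    | cons a w ih =>
      rw [lift_mk_cons]
      have h1 := FreeGroup.norm_mul_le (letterValue u a) (FreeGroup.lift u (FreeGroup.mk w))
      have h2 : (letterValue u a).norm ≤ L := by
        rcases a with ⟨a, _ | _⟩
        · simpa [letterValue, FreeGroup.norm_inv_eq] using h a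
        · simpa [letterValue] using h a
      rw [List.length_cons, mul_add, mul_one]
      omega
  have := key g.toWord
  rwa [FreeGroup.mk_toWord] at this

/-- Generators of one finite family can be written in terms of another one, in bounded length. -/
theorem exists_lift_comp_eq [DecidableEq α] [Finite ι] {x : ι → G} {y : α → G}
    (hy : Function.Surjective (FreeGroup.lift y)) : ∃ (ψ : FreeGroup ι →* FreeGroup α) (L : ℕ),
      0 < L ∧ (∀ g, FreeGroup.lift y (ψ g) = FreeGroup.lift x g) ∧
      ∀ w : List (ι × Bool), (ψ (FreeGroup.mk w)).norm ≤ L * w.length := by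
  classical
  choose u hu using fun i => hy (x i)
  obtain ⟨L, hL⟩ := (Set.finite_range fun i => (u i).norm).bddAbove
  have hL' : ∀ i, (u i).norm ≤ L + 1 := fun i => (hL ⟨i, rfl⟩).trans (Nat.le_succ _)
  refine ⟨FreeGroup.lift u, L + 1, Nat.succ_pos _, fun g => ?_, fun w => ?_⟩
  · have : (FreeGroup.lift y).comp (FreeGroup.lift u) = FreeGroup.lift x := by
      ext i
      simp [hu]
    exact DFunLike.congr_fun this g
  · exact (norm_lift_le hL' _).trans (Nat.mul_le_mul_left _ FreeGroup.norm_mk_le)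

/-- An endomorphism compatible with the values in `G` moves a word of length `n` by about `n / m`
relations of length `O(m)`. -/
theorem exists_chunks [DecidableEq ι] {x : ι → G} {χ : FreeGroup ι →* FreeGroup ι} {M m : ℕ}
    (hm : 0 < m) (hχ : ∀ g, FreeGroup.lift x (χ g) = FreeGroup.lift x g)
    (hM : ∀ w : List (ι × Bool), (χ (FreeGroup.mk w)).norm ≤ M * w.length)
    (w : List (ι × Bool)) : ∃ k, k * m ≤ w.length + m ∧
      IsConjProductLE (shortRelations x ((1 + M) * m)) k
        (FreeGroup.mk w * (χ (FreeGroup.mk w))⁻¹) := by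
  induction hn : w.length using Nat.strong_induction_on generalizing w with
  | _ n ih =>
    have short : ∀ v : List (ι × Bool), v.length ≤ m →
        IsConjProductLE (shortRelations x ((1 + M) * m)) 1
          (FreeGroup.mk v * (χ (FreeGroup.mk v))⁻¹) := by
      intro v hv
      refine .of_mem (mem_shortRelations_of_norm_le ?_ ?_)
      · have h1 := FreeGroup.norm_mul_le (FreeGroup.mk v) (χ (FreeGroup.mk v))⁻¹
        have h2 : (FreeGroup.mk v).norm ≤ v.length := FreeGroup.norm_mk_le
        have h3 := hM v
        have h4 := Nat.mul_le_mul_left M hv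
        rw [FreeGroup.norm_inv_eq] at h1
        rw [add_mul, one_mul]
        omega
      · rw [map_mul, map_inv, hχ, mul_inv_cancel]
    rcases le_or_gt w.length m with hw | hw
    · exact ⟨1, by omega, short w hw⟩
    · obtain ⟨k, hk, h⟩ := ih (w.drop m).length (by rw [List.length_drop]; omega) (w.drop m) rfl
      rw [List.length_drop] at hk
      refine ⟨k + 1, by rw [add_mul, one_mul]; omega, ?_⟩
      have e : FreeGroup.mk w * (χ (FreeGroup.mk w))⁻¹ =
          FreeGroup.mk (w.take m) * (FreeGroup.mk (w.drop m) * (χ (FreeGroup.mk (w.drop m)))⁻¹) *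
            (FreeGroup.mk (w.take m))⁻¹ *
            (FreeGroup.mk (w.take m) * (χ (FreeGroup.mk (w.take m)))⁻¹) := by
        conv_lhs => rw [← List.take_append_drop m w, ← FreeGroup.mul_mk, map_mul]
        group
      rw [e]
      exact (h.conj _).mul (short _ (by rw [List.length_take]; omega))

end Transport

/-! ### The isoperimetric spectrum -/

section Spectrum

variable {α ι G : Type*} [Group G]

theorem spectrum_inClassF [Finite ι] (x : ι → G) :
    InClassF fun k m n => (spectrum x k m n : ℝ) := by
  refine ⟨fun k k' m n _ _ hk _ => ?_, fun k m m' n _ _ hk hm => ?_, fun k m n n' _ _ _ hn => ?_⟩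
  · obtain ⟨w, hw, hS, ha⟩ := (isGreatest_spectrum x k m n).1
    exact_mod_cast (isGreatest_spectrum x k' m n).2
      ⟨w, hw, Subgroup.normalClosure_mono (shortRelations_mono x hk) hS, ha⟩
  · obtain ⟨w, hw, hS, ha⟩ := (isGreatest_spectrum x k m' n).1
    have h1 : area (shortRelations x m) (FreeGroup.mk w) ≤ spectrum x k m n :=
      (isGreatest_spectrum x k m n).2 ⟨w, hw, hS, rfl⟩
    have h2 : spectrum x k m' n ≤ area (shortRelations x m) (FreeGroup.mk w) := by
      rw [ha]
      exact (((area_le_iff (mem_normalClosure_of_le x hk hS)).1 le_rfl).mono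
        (shortRelations_mono x hm) le_rfl).area_le
    exact_mod_cast h2.trans h1
  · obtain ⟨w, hw, hS, ha⟩ := (isGreatest_spectrum x k m n).1
    exact_mod_cast (isGreatest_spectrum x k m n').2 ⟨w, hw.trans hn, hS, ha⟩

theorem sq_div_inClassF : InClassF fun _ m n => ((n : ℝ) / (m : ℝ)) ^ 2 := by
  refine ⟨fun _ _ _ _ _ _ _ _ => le_rfl, fun k m m' n hk _ hkm hm => ?_,
    fun k m n n' _ _ _ hn => ?_⟩
  · have : (0 : ℝ) < m := by exact_mod_cast hk.trans_le hkm
    have : (m : ℝ) ≤ m' := by exact_mod_cast hm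
    gcongr
  · gcongr

/-- A quadratic bound for the Dehn function. -/
theorem exists_quadratic_bound [DecidableEq α] [Finite α] {R : Set (FreeGroup α)}
    (h : DehnLe (dehn R) fun n => n ^ 2) :
    ∃ K, ∀ g ∈ Subgroup.normalClosure R, IsConjProductLE R (K * g.norm ^ 2) g := by
  obtain ⟨C, -, hC⟩ := h
  refine ⟨C ^ 3 + C, fun g hg => ?_⟩
  rcases Nat.eq_zero_or_pos g.norm with h0 | h0
  · rw [FreeGroup.norm_eq_zero.1 h0]
    exact (IsConjProductLE.one R).mono subset_rfl (Nat.zero_le _)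
  · refine (area_le_iff hg).1 ?_
    have h1 : area R g ≤ dehn R g.norm :=
      (isGreatest_dehn R g.norm).2 ⟨g.toWord, le_rfl, by rwa [FreeGroup.mk_toWord],
        by rw [FreeGroup.mk_toWord]⟩
    refine h1.trans ((hC _ h0).trans ?_)
    have h2 : C * g.norm ≤ C * g.norm ^ 2 :=
      Nat.mul_le_mul_left _ (Nat.le_self_pow two_ne_zero _)
    dsimp only
    rw [add_mul, mul_pow]
    refine add_le_add (le_of_eq (by ring)) h2

/-- Upper bound: quadratic fillings give coarse fillings at every scale. -/
theorem spectrum_preceq [Finite α] [Finite ι] {x : ι → G} {y : α → G}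
    {R : Set (FreeGroup α)} {K : ℕ} (hR : R.Finite)
    (hker : ∀ g, FreeGroup.lift y g = 1 ↔ g ∈ Subgroup.normalClosure R)
    (hx : Function.Surjective (FreeGroup.lift x)) (hy : Function.Surjective (FreeGroup.lift y))
    [DecidableEq α]
    (hK : ∀ g ∈ Subgroup.normalClosure R, IsConjProductLE R (K * g.norm ^ 2) g) :
    Preceq (fun k m n => (spectrum x k m n : ℝ)) fun _ m n => ((n : ℝ) / (m : ℝ)) ^ 2 := by
  classical
  obtain ⟨ψ, L, hL, hψ, hψL⟩ := exists_lift_comp_eq (x := x) hy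
  obtain ⟨φ, L', hL', hφ, hφL⟩ := exists_lift_comp_eq (x := y) hx
  obtain ⟨ρ, hρ⟩ := (hR.image fun r => r.toWord.length).bddAbove
  have hRρ : ∀ r ∈ R, r.toWord.length ≤ ρ + 1 ∧ FreeGroup.lift y r = 1 := fun r hr =>
    ⟨(hρ ⟨r, hr, rfl⟩).trans (Nat.le_succ _), (hker r).2 (Subgroup.subset_normalClosure hr)⟩
  set ρ' := ρ + 1 with hρ'
  have hψφ : ∀ w : List (ι × Bool), ((φ.comp ψ) (FreeGroup.mk w)).norm ≤ L' * L * w.length := by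
    intro w
    have h1 := hφL (ψ (FreeGroup.mk w)).toWord
    rw [FreeGroup.mk_toWord] at h1
    refine h1.trans ?_
    rw [mul_assoc]
    exact Nat.mul_le_mul_left _ (hψL w)
  set C := L' * (45 * (ρ' * ρ')) + (1 + L' * L) + 8 * K * L ^ 2 + 5 * L + 6 with hC
  refine ⟨C, by omega, fun k m n hk hm hn hkm => ?_⟩
  obtain ⟨w, hw, hS, ha⟩ := (isGreatest_spectrum x k (C * m) n).1
  have hw1 : FreeGroup.lift x (FreeGroup.mk w) = 1 :=
    lift_eq_one_of_mem_normalClosure (fun s hs => hs.choose_spec.2.2) hS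
  -- A filling of the image of `w` in the generators `y`.
  set g := ψ (FreeGroup.mk w) with hg
  have hgn : g.norm ≤ L * n := (hψL w).trans (Nat.mul_le_mul_left _ hw)
  obtain ⟨A, hA, hgA⟩ := hK g ((hker g).1 (by rw [hψ, hw1]))
  obtain ⟨D⟩ := (fillable_of_isConjProduct hRρ hgA).nonempty_diagram
  obtain ⟨l, hl, hfill⟩ := D.exists_coarse_filling (Nat.succ_pos ρ) hm
  rw [FreeGroup.mk_toWord] at hfill
  have hfill' : IsConjProductLE (shortRelations x (C * m)) (l * 1) (φ g) := by
    refine hfill.map φ fun s hs => .of_mem (mem_shortRelations_of_norm_le ?_ ?_)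
    · obtain ⟨v, hv, rfl, -⟩ := hs
      refine (hφL v).trans ((Nat.mul_le_mul_left _ hv).trans ?_)
      calc L' * (45 * (ρ' * ρ' * m)) = L' * (45 * (ρ' * ρ')) * m := by ring
        _ ≤ C * m := Nat.mul_le_mul_right _ (by omega)
    · rw [hφ]
      exact hs.choose_spec.2.2
  obtain ⟨k', hk', hchunk⟩ := exists_chunks (x := x) (χ := φ.comp ψ) hm
    (fun g => by rw [MonoidHom.comp_apply, hφ, hψ]) hψφ w
  have htotal : IsConjProductLE (shortRelations x (C * m)) (k' + l * 1) (FreeGroup.mk w) := by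
    have := (hchunk.mono (shortRelations_mono x (Nat.mul_le_mul_right m
      (show 1 + L' * L ≤ C by omega))) le_rfl).mul hfill'
    rwa [MonoidHom.comp_apply, ← hg, inv_mul_cancel_right] at this
  have hN : spectrum x k (C * m) n ≤ k' + l := by
    rw [ha]
    simpa using htotal.area_le
  have hbound : (k' + l) * (m * m) ≤ C * (n * n) + C * (n * m) + C * (m * m) := by
    have h1 : k' * m * m ≤ (n + m) * m := Nat.mul_le_mul_right m (hk'.trans (by omega))
    have h2 : g.norm * m ≤ L * n * m := Nat.mul_le_mul_right m hgn
    have h3 : A ≤ K * (L * n) ^ 2 := hA.trans (Nat.mul_le_mul_left _ (Nat.pow_le_pow_left hgn 2))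
    have h4 : l * (m * m) ≤ 8 * (K * (L * n) ^ 2) + 5 * (L * n * m) + 5 * (m * m) := by
      refine hl.trans ?_
      change 8 * A + 5 * (g.norm * m) + 5 * (m * m) ≤ _
      omega
    have h5 : 8 * K * L ^ 2 * (n * n) ≤ C * (n * n) := Nat.mul_le_mul_right _ (by omega)
    have h6 : (5 * L + 1) * (n * m) ≤ C * (n * m) := Nat.mul_le_mul_right _ (by omega)
    have h7 : 6 * (m * m) ≤ C * (m * m) := Nat.mul_le_mul_right _ (by omega)
    calc (k' + l) * (m * m) = k' * m * m + l * (m * m) := by ring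
      _ ≤ (n + m) * m + (8 * (K * (L * n) ^ 2) + 5 * (L * n * m) + 5 * (m * m)) :=
          add_le_add h1 h4
      _ = 8 * K * L ^ 2 * (n * n) + (5 * L + 1) * (n * m) + 6 * (m * m) := by ring
      _ ≤ _ := by omega
  have hm' : (0 : ℝ) < m := by exact_mod_cast hm
  have hC1 : (1 : ℝ) ≤ C := by exact_mod_cast (show 1 ≤ C by omega)
  have hN' : (spectrum x k (C * m) n : ℝ) ≤ (k' + l : ℕ) := by exact_mod_cast hN
  have hb' : ((k' + l : ℕ) : ℝ) * (m * m) ≤ C * (n * n) + C * (n * m) + C * (m * m) := by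
    exact_mod_cast hbound
  refine hN'.trans ?_
  have h1 : ((k' + l : ℕ) : ℝ) ≤ C * ((n : ℝ) / m) ^ 2 + C * ((n : ℝ) / m) + C := by
    have : (C * ((n : ℝ) / m) ^ 2 + C * ((n : ℝ) / m) + C) =
        (C * (n * n) + C * (n * m) + C * (m * m)) / (m * m) := by
      field_simp
    rw [this, le_div_iff₀ (by positivity)]
    exact hb'
  refine h1.trans ?_
  have h2 : (n : ℝ) / m ≤ ((C * n : ℕ) : ℝ) / m := by
    gcongr
    exact_mod_cast Nat.le_mul_of_pos_left n (by omega)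
  dsimp only
  gcongr

/-- Lower bound: a word with large area over `R` has large area over the relations of length at
most `m`, as each of these has area `O(m ^ 2)` over `R`. -/
theorem preceq_spectrum [Finite α] [Finite ι] {x : ι → G} {y : α → G}
    {R : Set (FreeGroup α)} {K : ℕ} (hR : R.Finite)
    (hker : ∀ g, FreeGroup.lift y g = 1 ↔ g ∈ Subgroup.normalClosure R)
    (hx : Function.Surjective (FreeGroup.lift x)) (hy : Function.Surjective (FreeGroup.lift y))
    [DecidableEq α]
    (hK : ∀ g ∈ Subgroup.normalClosure R, IsConjProductLE R (K * g.norm ^ 2) g)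
    (hlow : DehnLe (fun n => n ^ 2) (dehn R)) :
    Preceq (fun _ m n => ((n : ℝ) / (m : ℝ)) ^ 2) fun k m n => (spectrum x k m n : ℝ) := by
  classical
  obtain ⟨ψ, L, hL, hψ, hψL⟩ := exists_lift_comp_eq (x := x) hy
  obtain ⟨φ, L', hL', hφ, hφL⟩ := exists_lift_comp_eq (x := y) hx
  obtain ⟨ρ, hρ⟩ := (hR.image fun r => r.toWord.length).bddAbove
  have hφψ : ∀ w : List (α × Bool), ((ψ.comp φ) (FreeGroup.mk w)).norm ≤ L * L' * w.length := by
    intro w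
    have h1 := hψL (φ (FreeGroup.mk w)).toWord
    rw [FreeGroup.mk_toWord] at h1
    refine h1.trans ?_
    rw [mul_assoc]
    exact Nat.mul_le_mul_left _ (hφL w)
  obtain ⟨C₀, hC₀, hlow⟩ := hlow
  set M := K * ((1 + L * L') * 1) ^ 2 with hM
  set C := C₀ * (C₀ + 1) * M + C₀ + C₀ * (K * L ^ 2) + L' * ρ + L' * C₀ with hC
  have hCpos : 0 < C := by omega
  refine ⟨C, hCpos, fun k m n hk hm hn hkm => ?_⟩
  -- A word `u` of length `O(n)` over `R` of area about `n ^ 2`.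
  obtain ⟨w, hw, hwR, ha⟩ := (isGreatest_dehn R (C₀ * n)).1
  set u := FreeGroup.mk w with hu
  have hφu : φ u ∈ Subgroup.normalClosure (shortRelations x (C * k)) := by
    have : Subgroup.normalClosure R ≤
        (Subgroup.normalClosure (shortRelations x (C * k))).comap φ := by
      refine Subgroup.normalClosure_le_normal fun r hr => Subgroup.subset_normalClosure ?_
      refine mem_shortRelations_of_norm_le ?_ ?_
      · have h1 := hφL r.toWord
        rw [FreeGroup.mk_toWord] at h1
        have h2 : r.toWord.length ≤ ρ := hρ ⟨r, hr, rfl⟩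
        refine h1.trans ((Nat.mul_le_mul_left _ h2).trans ?_)
        exact (show L' * ρ ≤ C by omega).trans (Nat.le_mul_of_pos_right C hk)
      · rw [hφ, hker]
        exact Subgroup.subset_normalClosure hr
    exact this hwR
  set N := area (shortRelations x m) (φ u) with hN
  have hNs : N ≤ spectrum x (C * k) m (C * n) := by
    refine (isGreatest_spectrum x (C * k) m (C * n)).2 ⟨(φ u).toWord, ?_, ?_, ?_⟩
    · refine (hφL w).trans ((Nat.mul_le_mul_left _ hw).trans ?_)
      rw [← mul_assoc]
      exact Nat.mul_le_mul_right _ (by omega)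
    · rwa [FreeGroup.mk_toWord]
    · rw [FreeGroup.mk_toWord]
  have hfill : IsConjProductLE (shortRelations x m) N (φ u) :=
    (area_le_iff (mem_normalClosure_of_le x hkm hφu)).1 le_rfl
  have hback : IsConjProductLE R (N * (K * (L * m) ^ 2)) (ψ (φ u)) := by
    refine hfill.map ψ fun s hs => ?_
    obtain ⟨v, hv, rfl, hv1⟩ := hs
    refine (hK _ ((hker _).1 (by rw [hψ, hv1]))).mono subset_rfl (Nat.mul_le_mul_left _ ?_)
    exact Nat.pow_le_pow_left ((hψL v).trans (Nat.mul_le_mul_left _ hv)) 2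
  obtain ⟨k', hk', hchunk⟩ := exists_chunks (x := y) (χ := ψ.comp φ) one_pos
    (fun g => by rw [MonoidHom.comp_apply, hψ, hφ]) hφψ w
  have hchunk' : IsConjProductLE R (k' * M) (u * (ψ (φ u))⁻¹) := by
    refine hchunk.map (MonoidHom.id _) fun s hs => ?_
    refine (hK s ((hker s).1 hs.choose_spec.2.2)).mono subset_rfl ?_
    exact Nat.mul_le_mul_left _ (Nat.pow_le_pow_left (norm_le_of_mem_shortRelations hs) 2)
  have harea : dehn R (C₀ * n) ≤ k' * M + N * (K * (L * m) ^ 2) := by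
    rw [ha]
    have := (hchunk'.mul hback).area_le
    rwa [inv_mul_cancel_right] at this
  have hbound : n ^ 2 ≤ C * n + C * (N * m ^ 2) := by
    have h1 : k' * M ≤ (C₀ + 1) * n * M := by
      refine Nat.mul_le_mul_right _ ?_
      rw [add_mul, one_mul]
      omega
    calc n ^ 2 ≤ C₀ * dehn R (C₀ * n) + C₀ * n := hlow n hn
      _ ≤ C₀ * ((C₀ + 1) * n * M + N * (K * (L * m) ^ 2)) + C₀ * n := by
          gcongr
          omega
      _ = (C₀ * (C₀ + 1) * M + C₀) * n + C₀ * (K * L ^ 2) * (N * m ^ 2) := by ring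
      _ ≤ C * n + C * (N * m ^ 2) := by
          gcongr <;> omega
  have hm' : (1 : ℝ) ≤ m := by exact_mod_cast hm
  have hb' : (n : ℝ) ^ 2 ≤ C * n + C * (N * m ^ 2) := by exact_mod_cast hbound
  have hNs' : (N : ℝ) ≤ (spectrum x (C * k) m (C * n) : ℝ) := by exact_mod_cast hNs
  have h1 : ((n : ℝ) / (C * m : ℕ)) ^ 2 ≤ ((n : ℝ) / m) ^ 2 := by
    gcongr
    exact_mod_cast Nat.le_mul_of_pos_left m hCpos
  have h2 : ((n : ℝ) / m) ^ 2 ≤ C * N + C * ((n : ℝ) / m) := by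
    rw [div_pow, div_le_iff₀ (by positivity)]
    have h3 : (C : ℝ) * n ≤ C * ((n : ℝ) / m) * m ^ 2 := by
      have : (C : ℝ) * ((n : ℝ) / m) * m ^ 2 = C * n * m := by
        field_simp
      rw [this]
      exact le_mul_of_one_le_right (by positivity) hm'
    nlinarith
  have h4 : (C : ℝ) * N ≤ C * (spectrum x (C * k) m (C * n) : ℝ) := by gcongr
  have h5 : (0 : ℝ) ≤ C := by positivity
  dsimp only
  linarith

end Spectrum

end IsoSpectrum

theorem corollary1p7 {G : Type*} [Group G]
    -- `G` has a finite presentation `⟨α ∣ R⟩` whose Dehn function is quadratic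
    {α : Type*} [Finite α] (R : Set (FreeGroup α)) (hR : R.Finite)
    (e : PresentedGroup R ≃* G)
    (hquad : IsoSpectrum.DehnEquiv (IsoSpectrum.dehn R) (fun n => n ^ 2))
    -- an arbitrary finite generating family of `G`
    {ι : Type*} [Finite ι] (x : ι → G) (hx : Subgroup.closure (Set.range x) = ⊤) :
    IsoSpectrum.SpectrumEquiv
      (fun k m n => (IsoSpectrum.spectrum x k m n : ℝ))
      (fun _ m n => ((n : ℝ) / (m : ℝ)) ^ 2) := by
  classical
  let y : α → G := fun a => e (PresentedGroup.of a)
  have hy : ∀ g, FreeGroup.lift y g = e (PresentedGroup.mk R g) := by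
    have : FreeGroup.lift y = e.toMonoidHom.comp (PresentedGroup.mk R) := by
      ext a
      simp [y, PresentedGroup.of]
    exact fun g => DFunLike.congr_fun this g
  have hker : ∀ g, FreeGroup.lift y g = 1 ↔ g ∈ Subgroup.normalClosure R := by
    intro g
    rw [hy, EmbeddingLike.map_eq_one_iff]
    exact QuotientGroup.eq_one_iff g
  have hys : Function.Surjective (FreeGroup.lift y) := by
    intro g
    obtain ⟨h, hh⟩ := QuotientGroup.mk_surjective (e.symm g)
    refine ⟨h, ?_⟩
    rw [hy]
    exact (congrArg e hh).trans (e.apply_symm_apply g)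
  have hxs : Function.Surjective (FreeGroup.lift x) := by
    rw [← MonoidHom.range_eq_top, FreeGroup.range_lift_eq_closure, hx]
  obtain ⟨K, hK⟩ := IsoSpectrum.exists_quadratic_bound hquad.1
  exact ⟨IsoSpectrum.spectrum_inClassF x, IsoSpectrum.sq_div_inClassF,
    IsoSpectrum.spectrum_preceq hR hker hxs hys hK,
    IsoSpectrum.preceq_spectrum hR hker hxs hys hK hquad.2⟩
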